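/- Let $A=(a_{ij})$ be an $n\times n$ matrix with entries in $\mathbb R_+=[0,\infty)$. Matrix products and powers $A^t$ are taken in max-times algebra: $(A\otimes B)_{ij}=\max_k a_{ik}b_{kj}$, $(A\otimes y)_i=\max_k a_{ik}y_k$, $A^0=I$, and $a\oplus b=\max(a,b)$ (componentwise for vectors). We write $A^ty$ for $A^t\otimes y$. Let $D(A)$ be the digraph with nodes $1,\dots,n$ and an edge $(i,j)$ whenever $a_{ij}\neq 0$. A path may repeat nodes, and its length is its number of edges. The weight $w(P)$ of a path $P$ is the product of the entries $a_{ij}$ over its edges. A cycle is a path of length at least $1$ whose first and last nodes coincide. It is simple if it repeats no other node. Nodes $i,j$ are in the same component of $D(A)$ if each can be connected to the other by a path (of length $\ge 0$). A component is nontrivial if its nodes belong to cycles; a node that belongs to no cycle forms a trivial component. Let $L$ be the set of nodes in nontrivial components. The maximum cycle geometric mean of a component is the maximum of $w(P)^{1/k}$ over all cycles $P$ in it, where $k$ is the length of $P$. For a node $i$, let $\lambda(i)$ be the maximum cycle geometric mean of the component of $i$ if $i\in L$, and $\lambda(i)=0$ otherwise. The critical digraph of a nontrivial component consists of all nodes and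 edges of the cycles in it that attain this maximum. The cyclicity of a strongly connected digraph with at least one edge is the greatest common divisor of the lengths of its simple cycles. Let $\gamma$ be the least common multiple of the cyclicities of all strongly connected components of the critical digraphs of all nontrivial components of $D(A)$ ($\gamma=1$ if there are none). For $y\in\mathbb R_+^n$, the sequence $\{A^ty,\ t\ge 0\}$ is called ultimately linear periodic if there is $\lambda(y)\in\mathbb R_+$ such that $A^{t+\gamma}y=\lambda(y)^{\gamma}A^ty$ for all sufficiently large $t$. The matrix $A$ is called orbit periodic if $\{A^ty,\ t\ge 0\}$ is ultimately linear periodic for every $y\in\mathbb R_+^n$. We say that $i$ accesses $j$ if some path connects $i$ to $j$, and that $i$ strongly accesses $j$ if there is $T_{ij}$ such that for every $t\ge T_{ij}$ some path of length $t$ connects $i$ to $j$. Let $e_i$ be the $i$-th unit vector. **Theorem (Orbit periodicity).** $A$ is orbit periodic if and only if the following conditions hold for all $i,j\in L$: 1. if $i$ accesses $j$, then $\lambda(i)\le\lambda(j)$; 2. if neither $j$ strongly accesses $i$ nor $i$ strongly accesses $j$, then $\lambda(i)=\lambda(j)$. Equivalently, $A$ is orbit periodic if and only if $\{A^t(e_i\oplus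 e_j),\ t\ge 0\}$ is ultimately linear periodic for all $i,j\in L$. -/

import Mathlib

open scoped NNReal

noncomputable section

namespace MaxAlgebra

/-! ### Digraphs -/

/-- `p 0, p 1, …, p t` is a path of length `t` (number of edges) in `G`; nodes may be repeated. -/
def IsPath {V : Type*} (G : Digraph V) {t : ℕ} (p : Fin (t + 1) → V) : Prop :=
  ∀ s : Fin t, G.Adj (p s.castSucc) (p s.succ)

/-- The node `i` can be connected to the node `j` by a path of length `t`. -/
def HasPath {V : Type*} (G : Digraph V) (t : ℕ) (i j : V) : Prop :=
  ∃ p : Fin (t + 1) → V, IsPath G p ∧ p 0 = i ∧ p (Fin.last t) = j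

/-- `i` accesses `j`: some path connects `i` to `j`. -/
def Accesses {V : Type*} (G : Digraph V) (i j : V) : Prop :=
  ∃ t : ℕ, HasPath G t i j

/-- `i` strongly accesses `j`: paths of all sufficiently large lengths connect `i` to `j`. -/
def StronglyAccesses {V : Type*} (G : Digraph V) (i j : V) : Prop :=
  ∃ T : ℕ, ∀ t : ℕ, T ≤ t → HasPath G t i j

/-- `i` and `j` lie in the same (strongly connected) component. -/
def SameComponent {V : Type*} (G : Digraph V) (i j : V) : Prop :=
  Accesses G i j ∧ Accesses G j i

/-- A cycle of length `k ≥ 1`, written as a path whose last node is its first node. -/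
def IsCycle {V : Type*} (G : Digraph V) {k : ℕ} (p : Fin (k + 1) → V) : Prop :=
  1 ≤ k ∧ IsPath G p ∧ p 0 = p (Fin.last k)

/-- A simple cycle: the nodes `p 0, …, p (k - 1)` are pairwise distinct. -/
def IsSimpleCycle {V : Type*} (G : Digraph V) {k : ℕ} (p : Fin (k + 1) → V) : Prop :=
  IsCycle G p ∧ Function.Injective fun s : Fin k => p s.castSucc

/-- The node `i` belongs to a cycle, i.e. to a nontrivial component. -/
def OnCycle {V : Type*} (G : Digraph V) (i : V) : Prop :=
  ∃ k : ℕ, 1 ≤ k ∧ HasPath G k i i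

/-- The cyclicity of the component of `i`: the g.c.d. of the lengths of its simple cycles. -/
def componentCyclicity {V : Type*} (G : Digraph V) (i : V) : ℕ :=
  Nat.setGcd {k : ℕ | ∃ p : Fin (k + 1) → V, IsSimpleCycle G p ∧ SameComponent G i (p 0)}

open Classical in
/-- The cyclicity of a digraph: the l.c.m. of the cyclicities of its nontrivial components
(`1` if there are none). -/
def cyclicity {V : Type*} [Fintype V] (G : Digraph V) : ℕ :=
  (Finset.univ.filter fun i => OnCycle G i).lcm (componentCyclicity G)

/-! ### Max algebra -/

/-- The max-algebraic product of matrices: `(A ⊗ B) i j = max_k (A i k * B k j)`. -/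
def mul {n : ℕ} (A B : Matrix (Fin n) (Fin n) ℝ≥0) : Matrix (Fin n) (Fin n) ℝ≥0 :=
  Matrix.of fun i j => Finset.univ.sup fun k => A i k * B k j

/-- The max-algebraic product of a matrix and a vector: `(A ⊗ y) i = max_k (A i k * y k)`. -/
def mulVec {n : ℕ} (A : Matrix (Fin n) (Fin n) ℝ≥0) (y : Fin n → ℝ≥0) : Fin n → ℝ≥0 :=
  fun i => Finset.univ.sup fun k => A i k * y k

/-- Max-algebraic powers of a matrix. -/
def pow {n : ℕ} (A : Matrix (Fin n) (Fin n) ℝ≥0) : ℕ → Matrix (Fin n) (Fin n) ℝ≥0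
  | 0 => 1
  | t + 1 => mul (pow A t) A

/-- The digraph associated with `A`: there is an edge `(i, j)` iff `A i j ≠ 0`. -/
def digraph {n : ℕ} (A : Matrix (Fin n) (Fin n) ℝ≥0) : Digraph (Fin n) where
  Adj i j := A i j ≠ 0

/-- The weight of a path: the product of the weights of its edges. -/
def weight {n : ℕ} (A : Matrix (Fin n) (Fin n) ℝ≥0) {t : ℕ} (p : Fin (t + 1) → Fin n) : ℝ≥0 :=
  ∏ s : Fin t, A (p s.castSucc) (p s.succ)

open Classical in
/-- The maximum cycle geometric mean of `A`: the maximum of `w(P) ^ (1 / k)` over the cycles `P`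
of length `k = 1, …, n` in the digraph of `A` (`0` if there are no cycles). -/
def mcgm {n : ℕ} (A : Matrix (Fin n) (Fin n) ℝ≥0) : ℝ≥0 :=
  (Finset.Icc 1 n).sup fun k =>
    (Finset.univ.filter fun p : Fin (k + 1) → Fin n => IsCycle (digraph A) p).sup fun p =>
      weight A p ^ (1 / (k : ℝ))

/-- The critical digraph of `A`: its edges are those of the critical cycles of `A`, that is, of the
cycles whose geometric mean is `mcgm A`. -/
def criticalDigraph {n : ℕ} (A : Matrix (Fin n) (Fin n) ℝ≥0) : Digraph (Fin n) where
  Adj i j := ∃ (k : ℕ) (p : Fin (k + 1) → Fin n), IsCycle (digraph A) p ∧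
    weight A p ^ (1 / (k : ℝ)) = mcgm A ∧ ∃ s : Fin k, p s.castSucc = i ∧ p s.succ = j

open Classical in
/-- The part of `A` carried by the component of the node `i`: all entries outside the rows and
columns of this component are replaced by `0`. -/
def componentMatrix {n : ℕ} (A : Matrix (Fin n) (Fin n) ℝ≥0) (i : Fin n) :
    Matrix (Fin n) (Fin n) ℝ≥0 :=
  Matrix.of fun k l =>
    if SameComponent (digraph A) i k ∧ SameComponent (digraph A) i l then A k l else 0

/-- `λ(i)`: the maximum cycle geometric mean of the component of `i` (`0` if it is trivial). -/
def nodeMcgm {n : ℕ} (A : Matrix (Fin n) (Fin n) ℝ≥0) (i : Fin n) : ℝ≥0 :=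
  mcgm (componentMatrix A i)

/-- The joint cyclicity (l.c.m.) of the critical digraphs of all components of the digraph
of `A`; a trivial component contributes `1`. -/
def jointCyclicity {n : ℕ} (A : Matrix (Fin n) (Fin n) ℝ≥0) : ℕ :=
  Finset.univ.lcm fun i : Fin n => cyclicity (criticalDigraph (componentMatrix A i))

/-- The orbit `A^t ⊗ y`, `t ≥ 0`, is ultimately linear periodic, with ultimate growth rate `r`:
`A^(t+γ) ⊗ y = r^γ (A^t ⊗ y)` for all large `t`, where `γ` is the joint cyclicity. -/
def UltimatelyLinearPeriodic {n : ℕ} (A : Matrix (Fin n) (Fin n) ℝ≥0) (y : Fin n → ℝ≥0) : Prop :=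
  ∃ r : ℝ≥0, ∃ T : ℕ, ∀ t : ℕ, T ≤ t →
    mulVec (pow A (t + jointCyclicity A)) y = r ^ jointCyclicity A • mulVec (pow A t) y

/-- `A` is orbit periodic: all its orbits are ultimately linear periodic. -/
def OrbitPeriodic {n : ℕ} (A : Matrix (Fin n) (Fin n) ℝ≥0) : Prop :=
  ∀ y : Fin n → ℝ≥0, UltimatelyLinearPeriodic A y

/-- The `i`-th unit vector. -/
def unitVec {n : ℕ} (i : Fin n) : Fin n → ℝ≥0 := Pi.single i 1

end MaxAlgebra

end

/-!
An orbit `A ^ t ⊗ y` only sees the nodes that access the support of `y`. Let `μ` be the largest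
value of `λ` among them and divide by `μ`, so that all closed paths have weight at most `1`. A
path through a critical node can be cut at repeated nodes and lengthened again by critical
closed paths, so the paths through critical nodes contribute an ultimately periodic sequence,
while the weights of the paths avoiding them tend to `0`. Hence the orbit is ultimately linear
periodic with rate `μ` as soon as, for large `t`, a path of length `t` from a node to the
support of `y` can always be replaced by one through a critical node. Under the two conditions,
a node `l` on a cycle of the path either has `λ(l) = μ`, and then its own component is critical,
or strongly accesses every critical node.

Conversely, the rate of an ultimately linear periodic orbit is at least `λ(i)` for every `i`
that accesses the support of `y`, and it is at most `λ(i)` if only closed paths contribute to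
the entry `i`. For `y = e_j` this gives condition 1. If `i` does not strongly access `j`, then
some `i'` in the component of `i` has no path to `j` of the same length as a closed path through
`i'`, so for `y = e_{i'} ⊕ e_j` the rate equals both `λ(i)` and `λ(j)`, provided that `j` does
not access `i`.
-/

namespace MaxAlgebra

open Filter Topology

/-! ### Paths in digraphs -/

section Paths

variable {V : Type*} {G : Digraph V}

lemma exists_eq_seq_coe {α : Type*} {t : ℕ} (p : Fin (t + 1) → α) :
    ∃ q : ℕ → α, p = fun s : Fin (t + 1) => q s :=
  ⟨fun s => p (Fin.ofNat (t + 1) s), funext fun s => congrArg p (Fin.ofNat_val_eq_self s).symm⟩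

lemma HasPath.exists_seq {t : ℕ} {i j : V} (h : HasPath G t i j) :
    ∃ q : ℕ → V, q 0 = i ∧ q t = j ∧ ∀ s < t, G.Adj (q s) (q (s + 1)) := by
  obtain ⟨p, hp, rfl, rfl⟩ := h
  obtain ⟨q, rfl⟩ := exists_eq_seq_coe p
  exact ⟨q, rfl, rfl, fun s hs => hp ⟨s, hs⟩⟩

lemma hasPath_of_seq {q : ℕ → V} {a b : ℕ} (hab : a ≤ b)
    (hq : ∀ s, a ≤ s → s < b → G.Adj (q s) (q (s + 1))) : HasPath G (b - a) (q a) (q b) :=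
  ⟨fun s => q (a + s), fun s => hq _ (by omega) (by simp; omega), rfl, by
    simp [Nat.add_sub_cancel' hab]⟩

lemma hasPath_zero {i j : V} : HasPath G 0 i j ↔ i = j :=
  ⟨fun ⟨_, _, h0, h1⟩ => h0.symm.trans h1, fun h => ⟨fun _ => i, fun s => s.elim0, rfl, h⟩⟩

lemma HasPath.trans {a b : ℕ} {i l j : V} (h : HasPath G a i l) (h' : HasPath G b l j) :
    HasPath G (a + b) i j := by
  obtain ⟨q, rfl, rfl, hq⟩ := h.exists_seq
  obtain ⟨q', h0, rfl, hq'⟩ := h'.exists_seq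
  have key := hasPath_of_seq (G := G) (q := fun s => if s ≤ a then q s else q' (s - a))
    (Nat.zero_le (a + b)) fun s _ hs => by
      rcases lt_trichotomy s a with hsa | rfl | hsa
      · simpa [hsa.le, Nat.succ_le_of_lt hsa] using hq s hsa
      · simpa [h0] using hq' 0 (by omega)
      · have := hq' (s - a) (by omega)
        rw [← Nat.sub_add_comm hsa.le] at this
        simpa [hsa.not_ge, show ¬ s + 1 ≤ a by omega] using this
  rcases Nat.eq_zero_or_pos b with rfl | hb
  · simpa [h0] using key
  · simpa [hb.ne'] using key

lemma hasPath_succ {t : ℕ} {i j : V} :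
    HasPath G (t + 1) i j ↔ ∃ l, HasPath G t i l ∧ G.Adj l j := by
  constructor
  · intro h
    obtain ⟨q, rfl, rfl, hq⟩ := h.exists_seq
    exact ⟨q t, hasPath_of_seq (Nat.zero_le t) fun s _ hs => hq s (by omega), hq t (by omega)⟩
  · rintro ⟨l, hl, hlj⟩
    exact hl.trans ⟨![l, j], fun s => by simpa [Fin.fin_one_eq_zero s] using hlj, rfl, rfl⟩

lemma HasPath.exists_add {a b : ℕ} {i j : V} (h : HasPath G (a + b) i j) :
    ∃ l, HasPath G a i l ∧ HasPath G b l j := by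
  obtain ⟨q, rfl, rfl, hq⟩ := h.exists_seq
  refine ⟨q a, hasPath_of_seq (Nat.zero_le a) fun s _ hs => hq s (by omega), ?_⟩
  simpa using hasPath_of_seq (a.le_add_right b) fun s _ hs => hq s hs

/-- The lengths of the closed paths through a node, as a submonoid of `ℕ`. -/
def returnTimes (G : Digraph V) (v : V) : AddSubmonoid ℕ where
  carrier := {m | HasPath G m v v}
  zero_mem' := hasPath_zero.2 rfl
  add_mem' := HasPath.trans

lemma HasPath.mul_left {m : ℕ} {v : V} (h : HasPath G m v v) (r : ℕ) : HasPath G (r * m) v v :=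
  (returnTimes G v).nsmul_mem h r

lemma Accesses.refl (i : V) : Accesses G i i := ⟨0, hasPath_zero.2 rfl⟩

lemma Accesses.trans {i l j : V} : Accesses G i l → Accesses G l j → Accesses G i j :=
  fun ⟨a, ha⟩ ⟨b, hb⟩ => ⟨a + b, ha.trans hb⟩

lemma StronglyAccesses.accesses {i j : V} : StronglyAccesses G i j → Accesses G i j :=
  fun ⟨T, hT⟩ => ⟨T, hT T le_rfl⟩

lemma SameComponent.refl (i : V) : SameComponent G i i := ⟨.refl i, .refl i⟩

lemma SameComponent.symm {i j : V} (h : SameComponent G i j) : SameComponent G j i := ⟨h.2, h.1⟩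

lemma SameComponent.trans {i j l : V} (h : SameComponent G i j) (h' : SameComponent G j l) :
    SameComponent G i l :=
  ⟨h.1.trans h'.1, h'.2.trans h.2⟩

lemma SameComponent.onCycle {i j : V} (h : SameComponent G i j) (hi : OnCycle G i) :
    OnCycle G j := by
  obtain ⟨⟨a, ha⟩, b, hb⟩ := h
  obtain ⟨k, hk, hp⟩ := hi
  exact ⟨b + k + a, by omega, (hb.trans hp).trans ha⟩

lemma exists_repeat [Fintype V] {N : ℕ} (hN : 0 < N) (q : ℕ → V) :
    ∃ a b, a < b ∧ b ≤ Fintype.card V * N ∧ a ≡ b [MOD N] ∧ q a = q b := by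
  obtain ⟨a, b, hab, he⟩ := Fintype.exists_ne_map_eq_of_card_lt
    (fun s : Fin (Fintype.card V * N + 1) => (q s, (⟨s % N, Nat.mod_lt _ hN⟩ : Fin N)))
    (by simp)
  wlog h : a < b generalizing a b
  · exact this b a hab.symm he.symm (lt_of_le_of_ne (not_lt.1 h) hab.symm)
  simp only [Prod.mk.injEq, Fin.mk.injEq] at he
  exact ⟨a, b, h, by omega, he.2, he.1⟩

lemma HasPath.exists_closed_subpath [Fintype V] {N : ℕ} (hN : 0 < N) {t : ℕ} {i k : V}
    (ht : Fintype.card V * N ≤ t) (h : HasPath G t i k) :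
    ∃ v a l b, 0 < l ∧ N ∣ l ∧ a + l ≤ Fintype.card V * N ∧ a + l + b = t ∧
      HasPath G a i v ∧ HasPath G l v v ∧ HasPath G b v k := by
  obtain ⟨q, rfl, rfl, hq⟩ := h.exists_seq
  obtain ⟨a, b, hab, hb, hmod, he⟩ := exists_repeat hN q
  have segment : ∀ c d, c ≤ d → d ≤ t → HasPath G (d - c) (q c) (q d) :=
    fun c d hcd hd => hasPath_of_seq hcd fun s _ hs => hq s (by omega)
  refine ⟨q a, a, b - a, t - b, by omega, (Nat.modEq_iff_dvd' hab.le).1 hmod, by omega, by omega,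
    segment 0 a (by omega) (by omega), ?_, ?_⟩
  · simpa only [he] using segment a b hab.le (by omega)
  · simpa only [he] using segment b t (by omega) le_rfl

lemma HasPath.exists_short [Fintype V] {N : ℕ} (hN : 0 < N) {t : ℕ} {i k : V}
    (h : HasPath G t i k) :
    ∃ t' < Fintype.card V * N, t' ≤ t ∧ t' ≡ t [MOD N] ∧ HasPath G t' i k := by
  induction t using Nat.strong_induction_on with
  | _ t ih =>
    rcases Nat.lt_or_ge t (Fintype.card V * N) with hlt | hge
    · exact ⟨t, hlt, le_rfl, rfl, h⟩
    obtain ⟨v, a, l, b, hl, hNl, -, rfl, ha, -, hb⟩ := h.exists_closed_subpath hN hge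
    obtain ⟨t', hlt, hle, hmod, hp⟩ := ih (a + b) (by omega) (ha.trans hb)
    refine ⟨t', hlt, by omega, hmod.trans ((Nat.modEq_iff_dvd' (by omega)).2 ?_), hp⟩
    rwa [show a + l + b - (a + b) = l by omega]

/-! ### Periods of nodes -/

/-- The period of a node: the g.c.d. of the lengths of all closed paths through it, not only of
the simple ones. -/
noncomputable def period (G : Digraph V) (v : V) : ℕ := Nat.setGcd (returnTimes G v)

lemma period_dvd {m : ℕ} {v u : V} (h : SameComponent G v u) (hm : HasPath G m u u) :
    period G v ∣ m := by
  obtain ⟨⟨a, ha⟩, b, hb⟩ := h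
  have hab : period G v ∣ a + b := Nat.setGcd_dvd_of_mem (ha.trans hb)
  have hamb : period G v ∣ a + m + b := Nat.setGcd_dvd_of_mem ((ha.trans hm).trans hb)
  rw [show a + m + b = (a + b) + m by omega] at hamb
  exact (Nat.dvd_add_right hab).1 hamb

lemma eventually_hasPath_of_period_dvd (v : V) :
    ∀ᶠ m in atTop, period G v ∣ m → HasPath G m v v := by
  obtain ⟨T, hT⟩ := Nat.exists_mem_closure_of_ge (returnTimes G v : Set ℕ)
  rw [AddSubmonoid.closure_eq] at hT
  exact eventually_atTop.2 ⟨T, hT⟩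

lemma OnCycle.period_pos {v : V} (h : OnCycle G v) : 0 < period G v := by
  obtain ⟨k, hk, hp⟩ := h
  exact Nat.pos_of_dvd_of_pos (period_dvd (.refl v) hp) hk

lemma period_dvd_componentCyclicity (v : V) : period G v ∣ componentCyclicity G v := by
  refine Nat.dvd_setGcd_iff.2 ?_
  rintro k ⟨p, ⟨⟨-, hp, hcl⟩, -⟩, hv⟩
  exact period_dvd hv ⟨p, hp, rfl, hcl.symm⟩

lemma OnCycle.exists_isSimpleCycle {v : V} (h : OnCycle G v) :
    ∃ (k : ℕ) (p : Fin (k + 1) → V), IsSimpleCycle G p ∧ p 0 = v := by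
  classical
  -- a closed path of minimal length through `v` is simple
  obtain ⟨hk, hp⟩ := Nat.find_spec h
  set k := Nat.find h
  obtain ⟨q, h0, hqk, hq⟩ := hp.exists_seq
  have q_ne : ∀ a b, a < b → b < k → q a ≠ q b := by
    intro a b hab hb he
    have h1 := hasPath_of_seq (Nat.zero_le a) fun s _ hs => hq s (by omega)
    have h2 := hasPath_of_seq hb.le fun s _ hs => hq s (by omega)
    rw [h0, he] at h1
    rw [hqk] at h2
    have := Nat.find_min' h ⟨by omega, h1.trans h2⟩
    omega
  refine ⟨k, fun s => q s, ⟨⟨hk, fun s => hq s s.2, h0.trans hqk.symm⟩, fun a b hab => ?_⟩, h0⟩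
  rcases lt_trichotomy a b with hlt | heq | hlt
  · exact absurd hab (q_ne a b hlt b.2)
  · exact heq
  · exact absurd hab.symm (q_ne b a hlt a.2)

lemma OnCycle.componentCyclicity_ne_zero {v : V} (h : OnCycle G v) :
    componentCyclicity G v ≠ 0 := by
  obtain ⟨k, p, hp, rfl⟩ := h.exists_isSimpleCycle
  exact ne_zero_of_dvd_ne_zero (Nat.ne_of_gt hp.1.1)
    (Nat.setGcd_dvd_of_mem ⟨p, hp, .refl _⟩)

lemma cyclicity_ne_zero [Fintype V] : cyclicity G ≠ 0 := by
  classical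
  rw [cyclicity, Finset.lcm_ne_zero_iff]
  exact fun v hv => (Finset.mem_filter.1 hv).2.componentCyclicity_ne_zero

lemma OnCycle.period_dvd_cyclicity [Fintype V] {v : V} (h : OnCycle G v) :
    period G v ∣ cyclicity G := by
  classical
  exact (period_dvd_componentCyclicity v).trans (Finset.dvd_lcm (by simpa using h))

lemma OnCycle.exists_hasPath_sameComponent {i : V} (hi : OnCycle G i) (c : ℕ) :
    ∃ i', HasPath G c i i' ∧ SameComponent G i i' := by
  obtain ⟨k, hk, hp⟩ := hi
  obtain ⟨r, hr⟩ := Nat.exists_eq_add_of_le (Nat.le_mul_of_pos_right c hk)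
  obtain ⟨i', h1, h2⟩ := (hr ▸ hp.mul_left c).exists_add
  exact ⟨i', h1, ⟨c, h1⟩, ⟨r, h2⟩⟩

lemma OnCycle.stronglyAccesses_of_forall_modEq {i j : V} (hi : OnCycle G i)
    (h : ∀ c, ∃ a, HasPath G a i j ∧ a ≡ c [MOD period G i]) : StronglyAccesses G i j := by
  choose a ha hac using h
  obtain ⟨T, hT⟩ := eventually_atTop.1 (eventually_hasPath_of_period_dvd (G := G) i)
  refine ⟨T + (Finset.range (period G i)).sup a, fun t ht => ?_⟩
  set c := t % period G i
  have hle : a c ≤ (Finset.range (period G i)).sup a :=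
    Finset.le_sup (Finset.mem_range.2 (Nat.mod_lt _ hi.period_pos))
  have hdvd : period G i ∣ t - a c :=
    (Nat.modEq_iff_dvd' (by omega)).1 ((hac c).trans (Nat.mod_modEq _ _))
  simpa only [Nat.sub_add_cancel (show a c ≤ t by omega)] using
    (hT (t - a c) (by omega) hdvd).trans (ha c)

/-- If `i` does not strongly access `j`, the lengths of the paths from `i` to `j` miss a residue
class modulo the period of `i`; moving `i` along a cycle turns it into the class of the closed
paths. -/
lemma OnCycle.exists_disjoint_lengths {i j : V} (hi : OnCycle G i)
    (h : ¬ StronglyAccesses G i j) :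
    ∃ i', SameComponent G i i' ∧ ∀ t, HasPath G t i' i' → ¬ HasPath G t i' j := by
  by_contra! hc
  refine h (hi.stronglyAccesses_of_forall_modEq fun c => ?_)
  obtain ⟨i', hci, hs⟩ := hi.exists_hasPath_sameComponent c
  obtain ⟨t, ht, htj⟩ := hc i' hs
  have ht0 : t ≡ 0 [MOD period G i] := Nat.modEq_zero_iff_dvd.2 (period_dvd hs ht)
  exact ⟨c + t, hci.trans htj, by simpa using ht0.add_left c⟩

/-! ### Paths through a set of nodes -/

/-- The nodes of `G` that access the set `S`. -/
def accessingNodes (G : Digraph V) (S : Set V) : Set V :=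
  {v | ∃ k ∈ S, Accesses G v k}

lemma subset_accessingNodes (S : Set V) : S ⊆ accessingNodes G S :=
  fun k hk => ⟨k, hk, .refl k⟩

lemma Accesses.mem_accessingNodes {S : Set V} {u v : V} (h : Accesses G u v)
    (hv : v ∈ accessingNodes G S) : u ∈ accessingNodes G S := by
  obtain ⟨k, hk, hvk⟩ := hv
  exact ⟨k, hk, h.trans hvk⟩

/-- Some path of length `t` leads from `i` through a node of `C` to a node of `S`. -/
def HasPathThrough (G : Digraph V) (C S : Set V) (t : ℕ) (i : V) : Prop :=
  ∃ v ∈ C, ∃ k ∈ S, ∃ a b, a + b = t ∧ HasPath G a i v ∧ HasPath G b v k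

lemma HasPath.hasPathThrough {C S : Set V} {s t : ℕ} {i l : V} (h : HasPath G s i l)
    (hl : HasPathThrough G C S t l) : HasPathThrough G C S (s + t) i := by
  obtain ⟨v, hv, k, hk, a, b, rfl, ha, hb⟩ := hl
  exact ⟨v, hv, k, hk, s + a, b, add_assoc s a b, h.trans ha, hb⟩

lemma eventually_hasPathThrough_of_stronglyAccesses {C S : Set V} {l v : V} (hv : v ∈ C)
    (hvS : v ∈ accessingNodes G S) (h : StronglyAccesses G l v) :
    ∀ᶠ t in atTop, HasPathThrough G C S t l := by
  obtain ⟨T, hT⟩ := h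
  obtain ⟨k, hk, e, he⟩ := hvS
  filter_upwards [eventually_ge_atTop (T + e)] with t ht
  exact ⟨v, hv, k, hk, t - e, e, by omega, hT _ (by omega), he⟩

/-- A long path from `l` is shortened modulo the length of a closed path through `l` and `v`, and
then lengthened again by repeating that closed path. -/
lemma eventually_hasPathThrough_of_sameComponent [Finite V] {C S : Set V} {l v : V}
    (hl : OnCycle G l) (hv : v ∈ C) (h : SameComponent G l v) :
    ∀ᶠ t in atTop, (∃ k ∈ S, HasPath G t l k) → HasPathThrough G C S t l := by
  cases nonempty_fintype V
  obtain ⟨m, hm, hp⟩ := hl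
  obtain ⟨⟨d, hd⟩, e, he⟩ := h
  set N := d + e + m
  filter_upwards [eventually_ge_atTop (Fintype.card V * N)] with t ht
  rintro ⟨k, hk, hlk⟩
  obtain ⟨t', hlt, hle, hmod, ht'⟩ := hlk.exists_short (N := N) (by omega)
  obtain ⟨r, hr⟩ := (Nat.modEq_iff_dvd' hle).1 hmod
  obtain ⟨r, rfl⟩ : ∃ r', r = r' + 1 :=
    Nat.exists_eq_succ_of_ne_zero fun h0 => by rw [h0] at hr; omega
  have loops : HasPath G (r * N) l l := ((hd.trans he).trans hp).mul_left r
  refine ⟨v, hv, k, hk, d, e + m + r * N + t', ?_, hd, ((he.trans hp).trans loops).trans ht'⟩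
  rw [mul_add, mul_one, mul_comm] at hr
  omega

theorem eventually_hasPathThrough [Finite V] {C S : Set V} (hCS : C ⊆ accessingNodes G S)
    (h : ∀ l ∈ accessingNodes G S, OnCycle G l →
      ∃ v ∈ C, SameComponent G l v ∨ StronglyAccesses G l v) :
    ∀ᶠ t in atTop, ∀ i, (∃ k ∈ S, HasPath G t i k) → HasPathThrough G C S t i := by
  cases nonempty_fintype V
  have of_onCycle : ∀ l, ∀ᶠ t in atTop, OnCycle G l →
      (∃ k ∈ S, HasPath G t l k) → HasPathThrough G C S t l := by
    intro l
    by_cases hl : OnCycle G l ∧ l ∈ accessingNodes G S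
    · obtain ⟨v, hv, hs | hs⟩ := h l hl.2 hl.1
      · filter_upwards [eventually_hasPathThrough_of_sameComponent hl.1 hv hs] with t ht _ using ht
      · filter_upwards [eventually_hasPathThrough_of_stronglyAccesses hv (hCS hv) hs] with t ht _ _
          using ht
    · exact .of_forall fun t hlc ⟨k, hk, hlk⟩ => (hl ⟨hlc, k, hk, t, hlk⟩).elim
  obtain ⟨T, hT⟩ := eventually_atTop.1 (eventually_all.2 of_onCycle)
  filter_upwards [eventually_ge_atTop (Fintype.card V + T)] with t ht
  rintro i ⟨k, hk, hik⟩
  obtain ⟨l, a, m, b, hm, -, ham, rfl, hil, hll, hlk⟩ :=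
    hik.exists_closed_subpath one_pos (by omega)
  rw [add_assoc]
  exact hil.hasPathThrough (hT (m + b) (by omega) l ⟨m, hm, hll⟩ ⟨k, hk, hll.trans hlk⟩)

end Paths

/-! ### Max-algebraic powers -/

section Powers

variable {n : ℕ} {A : Matrix (Fin n) (Fin n) ℝ≥0}

lemma le_mul_apply (A B : Matrix (Fin n) (Fin n) ℝ≥0) (i k j : Fin n) :
    A i k * B k j ≤ mul A B i j :=
  Finset.le_sup (f := fun k => A i k * B k j) (Finset.mem_univ k)

lemma exists_mul_apply (A B : Matrix (Fin n) (Fin n) ℝ≥0) (i j : Fin n) :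
    ∃ k, mul A B i j = A i k * B k j := by
  obtain ⟨k, -, hk⟩ := Finset.exists_mem_eq_sup Finset.univ ⟨i, Finset.mem_univ i⟩
    (fun k => A i k * B k j)
  exact ⟨k, hk⟩

lemma le_mulVec_apply (A : Matrix (Fin n) (Fin n) ℝ≥0) (y : Fin n → ℝ≥0) (i k : Fin n) :
    A i k * y k ≤ mulVec A y i :=
  Finset.le_sup (f := fun k => A i k * y k) (Finset.mem_univ k)

lemma exists_mulVec_apply (A : Matrix (Fin n) (Fin n) ℝ≥0) (y : Fin n → ℝ≥0) (i : Fin n) :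
    ∃ k, mulVec A y i = A i k * y k := by
  obtain ⟨k, -, hk⟩ := Finset.exists_mem_eq_sup Finset.univ ⟨i, Finset.mem_univ i⟩
    (fun k => A i k * y k)
  exact ⟨k, hk⟩

lemma smul_mulVec (c : ℝ≥0) (A : Matrix (Fin n) (Fin n) ℝ≥0) (y : Fin n → ℝ≥0) :
    mulVec (c • A) y = c • mulVec A y := by
  funext i
  simp [mulVec, mul_assoc, NNReal.mul_finset_sup]

lemma pow_zero_self (i : Fin n) : pow A 0 i i = 1 := Matrix.one_apply_eq i

lemma pow_zero_of_ne {i j : Fin n} (h : i ≠ j) : pow A 0 i j = 0 := Matrix.one_apply_ne h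

lemma pow_add_le (s t : ℕ) (i l j : Fin n) : pow A s i l * pow A t l j ≤ pow A (s + t) i j := by
  induction t generalizing j with
  | zero =>
    rcases eq_or_ne l j with rfl | h
    · simp [pow_zero_self]
    · simp [pow_zero_of_ne h]
  | succ t ih =>
    obtain ⟨m, hm⟩ := exists_mul_apply (pow A t) A l j
    calc pow A s i l * pow A (t + 1) l j = pow A s i l * pow A t l m * A m j := by
          rw [pow, hm, mul_assoc]
      _ ≤ pow A (s + t) i m * A m j := by gcongr; exact ih m
      _ ≤ pow A (s + (t + 1)) i j := le_mul_apply _ _ _ _ _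

lemma pow_mul_mulVec_le (s t : ℕ) (y : Fin n → ℝ≥0) (i l : Fin n) :
    pow A s i l * mulVec (pow A t) y l ≤ mulVec (pow A (s + t)) y i := by
  obtain ⟨k, hk⟩ := exists_mulVec_apply (pow A t) y l
  rw [hk, ← mul_assoc]
  exact (mul_le_mul_left (pow_add_le s t i l k) _).trans (le_mulVec_apply _ _ _ _)

lemma pow_self_pow_le (m k : ℕ) (v : Fin n) : pow A m v v ^ k ≤ pow A (k * m) v v := by
  induction k with
  | zero => simp [pow_zero_self]
  | succ k ih =>
    rw [pow_succ, Nat.succ_mul]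
    exact (mul_le_mul_left ih _).trans (pow_add_le _ _ _ _ _)

lemma pow_smul (c : ℝ≥0) (t : ℕ) : pow (c • A) t = c ^ t • pow A t := by
  induction t with
  | zero => simp [pow]
  | succ t ih =>
    refine Matrix.ext fun i j => ?_
    simp only [pow, ih, mul, Matrix.of_apply, Matrix.smul_apply, smul_eq_mul,
      NNReal.mul_finset_sup]
    exact Finset.sup_congr rfl fun k _ => by ring

lemma digraph_smul {c : ℝ≥0} (hc : c ≠ 0) : digraph (c • A) = digraph A := by
  ext i j
  simp [digraph, hc]

/-- The weight of the part of a sequence of nodes between the indices `a` and `b`. -/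
def seqWeight (A : Matrix (Fin n) (Fin n) ℝ≥0) (q : ℕ → Fin n) (a b : ℕ) : ℝ≥0 :=
  ∏ s ∈ Finset.Ico a b, A (q s) (q (s + 1))

lemma seqWeight_mul (q : ℕ → Fin n) {a b c : ℕ} (hab : a ≤ b) (hbc : b ≤ c) :
    seqWeight A q a b * seqWeight A q b c = seqWeight A q a c :=
  Finset.prod_Ico_consecutive _ hab hbc

lemma seqWeight_le (q : ℕ → Fin n) {a b : ℕ} (hab : a ≤ b) :
    seqWeight A q a b ≤ pow A (b - a) (q a) (q b) := by
  induction b, hab using Nat.le_induction with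
  | base => simp [seqWeight, pow_zero_self]
  | succ b hab ih =>
    rw [seqWeight, Finset.prod_Ico_succ_top hab, Nat.sub_add_comm hab]
    exact (mul_le_mul_left ih _).trans (le_mul_apply _ _ _ _ _)

lemma seqWeight_ne_zero {q : ℕ → Fin n} {a b : ℕ} :
    seqWeight A q a b ≠ 0 ↔ ∀ s, a ≤ s → s < b → (digraph A).Adj (q s) (q (s + 1)) := by
  simp [seqWeight, Finset.prod_ne_zero_iff, digraph]

lemma exists_seqWeight_eq {t : ℕ} {i j : Fin n} (h : pow A t i j ≠ 0) :
    ∃ q : ℕ → Fin n, q 0 = i ∧ q t = j ∧ seqWeight A q 0 t = pow A t i j := by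
  induction t generalizing j with
  | zero =>
    obtain rfl : i = j := not_imp_comm.1 pow_zero_of_ne h
    exact ⟨fun _ => i, rfl, rfl, by simp [seqWeight, pow_zero_self]⟩
  | succ t ih =>
    obtain ⟨m, hm⟩ := exists_mul_apply (pow A t) A i j
    rw [pow, hm] at h
    obtain ⟨q, h0, rfl, hq⟩ := ih (left_ne_zero_of_mul h)
    refine ⟨fun s => if s ≤ t then q s else j, by simpa using h0, by simp, ?_⟩
    rw [seqWeight, Finset.prod_Ico_succ_top (Nat.zero_le t), pow, hm, ← hq, seqWeight]
    congr 1
    · refine Finset.prod_congr rfl fun s hs => ?_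
      have := (Finset.mem_Ico.1 hs).2
      simp [this.le, Nat.succ_le_of_lt this]
    · simp

lemma hasPath_digraph {t : ℕ} {i j : Fin n} : HasPath (digraph A) t i j ↔ pow A t i j ≠ 0 := by
  constructor
  · intro h
    obtain ⟨q, rfl, rfl, hq⟩ := h.exists_seq
    have h0 : 0 < seqWeight A q 0 t :=
      pos_of_ne_zero (seqWeight_ne_zero.2 fun s _ hs => hq s hs)
    exact (h0.trans_le (seqWeight_le q t.zero_le)).ne'
  · intro h
    obtain ⟨q, rfl, rfl, hq⟩ := exists_seqWeight_eq h
    exact hasPath_of_seq t.zero_le (seqWeight_ne_zero.1 (hq ▸ h))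

lemma onCycle_digraph {v : Fin n} : OnCycle (digraph A) v ↔ ∃ m, 1 ≤ m ∧ pow A m v v ≠ 0 := by
  simp only [OnCycle, hasPath_digraph]

lemma mulVec_pow_ne_zero {t : ℕ} {y : Fin n → ℝ≥0} {i : Fin n} :
    mulVec (pow A t) y i ≠ 0 ↔ ∃ k ∈ Function.support y, HasPath (digraph A) t i k := by
  constructor
  · intro h
    obtain ⟨k, hk⟩ := exists_mulVec_apply (pow A t) y i
    rw [hk] at h
    exact ⟨k, right_ne_zero_of_mul h, hasPath_digraph.2 (left_ne_zero_of_mul h)⟩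
  · rintro ⟨k, hk, hik⟩
    have h0 := pos_of_ne_zero (mul_ne_zero (hasPath_digraph.1 hik) hk)
    exact (h0.trans_le (le_mulVec_apply (pow A t) y i k)).ne'

lemma exists_pow_le_mul_mul {N : ℕ} (hN : 0 < N) {t : ℕ} (ht : n * N ≤ t) (i k : Fin n) :
    ∃ v a l b, 0 < l ∧ N ∣ l ∧ a + l ≤ n * N ∧ a + l + b = t ∧
      pow A t i k ≤ pow A a i v * pow A l v v * pow A b v k := by
  rcases eq_or_ne (pow A t i k) 0 with h | h
  · have hn : 0 < n := i.pos
    exact ⟨i, 0, n * N, t - n * N, by positivity, Dvd.intro_left n rfl, by omega, by omega,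
      h ▸ zero_le⟩
  obtain ⟨q, rfl, rfl, hq⟩ := exists_seqWeight_eq h
  obtain ⟨a, b, hab, hb, hmod, he⟩ := exists_repeat hN q
  rw [Fintype.card_fin] at hb
  refine ⟨q a, a, b - a, t - b, by omega, (Nat.modEq_iff_dvd' hab.le).1 hmod, by omega, by omega,
    ?_⟩
  have loop : seqWeight A q a b ≤ pow A (b - a) (q a) (q a) := by
    simpa only [he] using seqWeight_le (A := A) q hab.le
  have rest : seqWeight A q b t ≤ pow A (t - b) (q a) (q t) :=
    he ▸ seqWeight_le q (hb.trans ht)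
  rw [← hq, ← seqWeight_mul q b.zero_le (hb.trans ht), ← seqWeight_mul q a.zero_le hab.le]
  exact mul_le_mul' (mul_le_mul' (seqWeight_le q a.zero_le) loop) rest

lemma exists_short_pow_ge (hA : ∀ v m, pow A m v v ≤ 1) {N : ℕ} (hN : 0 < N) (t : ℕ)
    (i k : Fin n) :
    ∃ t' < n * N, t' ≡ t [MOD N] ∧ pow A t i k ≤ pow A t' i k := by
  induction t using Nat.strong_induction_on with
  | _ t ih =>
    rcases Nat.lt_or_ge t (n * N) with hlt | hge
    · exact ⟨t, hlt, rfl, le_rfl⟩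
    obtain ⟨v, a, l, b, hl, hNl, -, rfl, hle⟩ := exists_pow_le_mul_mul (A := A) hN hge i k
    obtain ⟨t', hlt, hmod, hle'⟩ := ih (a + b) (by omega)
    refine ⟨t', hlt, hmod.trans ((Nat.modEq_iff_dvd' (by omega)).2 ?_), ?_⟩
    · rwa [show a + l + b - (a + b) = l by omega]
    calc pow A (a + l + b) i k ≤ pow A a i v * pow A l v v * pow A b v k := hle
      _ ≤ pow A a i v * 1 * pow A b v k := by gcongr; exact hA v l
      _ ≤ pow A (a + b) i k := by rw [mul_one]; exact pow_add_le _ _ _ _ _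
      _ ≤ pow A t' i k := hle'

lemma exists_short_mulVec_pow_ge (hA : ∀ v m, pow A m v v ≤ 1) {N : ℕ} (hN : 0 < N) (t : ℕ)
    (y : Fin n → ℝ≥0) (i : Fin n) :
    ∃ t' < n * N, t' ≡ t [MOD N] ∧ mulVec (pow A t) y i ≤ mulVec (pow A t') y i := by
  obtain ⟨k, hk⟩ := exists_mulVec_apply (pow A t) y i
  obtain ⟨t', hlt, hmod, hle⟩ := exists_short_pow_ge hA hN t i k
  exact ⟨t', hlt, hmod, hk.trans_le ((mul_le_mul_left hle _).trans (le_mulVec_apply _ _ _ _))⟩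

/-! ### Restriction to a set of nodes -/

open Classical in
/-- The matrix `A` with all entries outside the rows and columns of `S` replaced by `0`. -/
noncomputable def restrict (A : Matrix (Fin n) (Fin n) ℝ≥0) (S : Set (Fin n)) :
    Matrix (Fin n) (Fin n) ℝ≥0 :=
  Matrix.of fun k l => if k ∈ S ∧ l ∈ S then A k l else 0

lemma restrict_apply_of_mem {S : Set (Fin n)} {k l : Fin n} (hk : k ∈ S) (hl : l ∈ S) :
    restrict A S k l = A k l :=
  if_pos ⟨hk, hl⟩

lemma restrict_apply_of_notMem_right {S : Set (Fin n)} {k l : Fin n} (hl : l ∉ S) :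
    restrict A S k l = 0 :=
  if_neg fun h => hl h.2

lemma pow_restrict_le (S : Set (Fin n)) (t : ℕ) (i j : Fin n) :
    pow (restrict A S) t i j ≤ pow A t i j := by
  have restrict_le : ∀ k l, restrict A S k l ≤ A k l := fun k l => by
    rw [restrict, Matrix.of_apply]
    split_ifs <;> simp
  induction t generalizing j with
  | zero => exact le_rfl
  | succ t ih =>
    obtain ⟨k, hk⟩ := exists_mul_apply (pow (restrict A S) t) (restrict A S) i j
    rw [pow, hk]
    exact (mul_le_mul' (ih k) (restrict_le k j)).trans (le_mul_apply _ _ _ _ _)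

lemma pow_restrict_of_notMem_right {S : Set (Fin n)} {m : ℕ} (hm : 1 ≤ m) {i j : Fin n}
    (hj : j ∉ S) : pow (restrict A S) m i j = 0 := by
  obtain ⟨m, rfl⟩ := Nat.exists_eq_add_of_le' hm
  obtain ⟨k, hk⟩ := exists_mul_apply (pow (restrict A S) m) (restrict A S) i j
  rw [pow, hk, restrict_apply_of_notMem_right hj, mul_zero]

lemma pow_le_pow_restrict_or (S : Set (Fin n)) (t : ℕ) (i k : Fin n) :
    pow A t i k ≤ pow (restrict A S) t i k ∨
      ∃ v ∉ S, ∃ a b, a + b = t ∧ pow A t i k ≤ pow A a i v * pow A b v k := by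
  rcases eq_or_ne (pow A t i k) 0 with h | h
  · exact .inl (h ▸ zero_le)
  obtain ⟨q, rfl, rfl, hq⟩ := exists_seqWeight_eq h
  by_cases hS : ∀ s ≤ t, q s ∈ S
  · left
    calc pow A t (q 0) (q t) = seqWeight A q 0 t := hq.symm
      _ = seqWeight (restrict A S) q 0 t := Finset.prod_congr rfl fun s hs => by
        have := (Finset.mem_Ico.1 hs).2
        exact (restrict_apply_of_mem (hS s this.le) (hS (s + 1) this)).symm
      _ ≤ pow (restrict A S) t (q 0) (q t) := seqWeight_le q t.zero_le
  · push Not at hS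
    obtain ⟨s, hs, hqs⟩ := hS
    refine .inr ⟨q s, hqs, s, t - s, by omega, ?_⟩
    rw [← hq, ← seqWeight_mul q s.zero_le hs]
    exact mul_le_mul' (seqWeight_le q s.zero_le) (seqWeight_le q hs)

lemma pow_restrict_eq {S : Set (Fin n)} {i j : Fin n}
    (hS : ∀ v, Accesses (digraph A) i v → Accesses (digraph A) v j → v ∈ S) (t : ℕ) :
    pow (restrict A S) t i j = pow A t i j := by
  refine le_antisymm (pow_restrict_le S t i j) ?_
  rcases pow_le_pow_restrict_or S t i j with h | ⟨v, hv, a, b, -, h⟩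
  · exact h
  have hab : pow A a i v * pow A b v j = 0 := by
    by_contra hne
    exact hv (hS v ⟨a, hasPath_digraph.2 (left_ne_zero_of_mul hne)⟩
      ⟨b, hasPath_digraph.2 (right_ne_zero_of_mul hne)⟩)
  exact (h.trans_eq hab).trans zero_le

end Powers

/-! ### Cycle means and critical nodes -/

section CycleMeans

variable {n : ℕ} {A : Matrix (Fin n) (Fin n) ℝ≥0}

lemma rpow_one_div_natCast_eq_iff {k : ℕ} (hk : 1 ≤ k) {x y : ℝ≥0} :
    x ^ (1 / (k : ℝ)) = y ↔ x = y ^ k := by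
  rw [one_div, NNReal.rpow_inv_eq_iff (by positivity), NNReal.rpow_natCast]

lemma weight_eq_seqWeight {t : ℕ} (q : ℕ → Fin n) :
    weight A (fun s : Fin (t + 1) => q s) = seqWeight A q 0 t := by
  rw [weight, seqWeight, ← Finset.range_eq_Ico, ← Fin.prod_univ_eq_prod_range]
  rfl

lemma weight_le_pow {t : ℕ} (p : Fin (t + 1) → Fin n) :
    weight A p ≤ pow A t (p 0) (p (Fin.last t)) := by
  obtain ⟨q, rfl⟩ := exists_eq_seq_coe p
  exact (weight_eq_seqWeight q).trans_le (seqWeight_le q t.zero_le)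

lemma exists_isCycle_weight_eq {m : ℕ} (hm : 1 ≤ m) {v : Fin n} (h : pow A m v v ≠ 0) :
    ∃ p : Fin (m + 1) → Fin n, IsCycle (digraph A) p ∧ weight A p = pow A m v v ∧ p 0 = v := by
  obtain ⟨q, rfl, hqm, hw⟩ := exists_seqWeight_eq h
  have adj := seqWeight_ne_zero.1 (hw ▸ h)
  exact ⟨fun s => q s, ⟨hm, fun s => adj s s.1.zero_le s.2, by simp [hqm]⟩,
    (weight_eq_seqWeight q).trans hw, rfl⟩

lemma weight_le_mcgm_pow {k : ℕ} (hk : k ≤ n) {p : Fin (k + 1) → Fin n}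
    (hp : IsCycle (digraph A) p) : weight A p ≤ mcgm A ^ k := by
  classical
  have root_le : weight A p ^ (1 / (k : ℝ)) ≤ mcgm A := by
    rw [mcgm]
    refine Finset.le_sup_of_le (Finset.mem_Icc.2 ⟨hp.1, hk⟩) ?_
    exact Finset.le_sup (f := fun p : Fin (k + 1) → Fin n => weight A p ^ (1 / (k : ℝ)))
      (by simpa using hp)
  rw [(rpow_one_div_natCast_eq_iff hp.1 (x := weight A p)).1 rfl]
  exact pow_le_pow_left' root_le k

/-- Cycles of length more than `n`, which `mcgm` ignores, split into shorter ones. -/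
lemma pow_le_mcgm_pow (v : Fin n) (m : ℕ) : pow A m v v ≤ mcgm A ^ m := by
  induction m using Nat.strong_induction_on generalizing v with
  | _ m ih =>
    rcases Nat.eq_zero_or_pos m with rfl | hm
    · simp [pow_zero_self]
    rcases Nat.lt_or_ge n m with hnm | hmn
    · obtain ⟨u, a, l, b, hl, -, hln, rfl, hle⟩ :=
        exists_pow_le_mul_mul (A := A) one_pos (t := m) (by omega) v v
      calc pow A (a + l + b) v v ≤ pow A a v u * pow A l u u * pow A b u v := hle
        _ = pow A a v u * pow A b u v * pow A l u u := by ring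
        _ ≤ mcgm A ^ (a + b) * mcgm A ^ l :=
          mul_le_mul' ((pow_add_le _ _ _ _ _).trans (ih _ (by omega) v)) (ih _ (by omega) u)
        _ = mcgm A ^ (a + l + b) := by ring
    · rcases eq_or_ne (pow A m v v) 0 with h | h
      · simp [h]
      obtain ⟨p, hp, hw, -⟩ := exists_isCycle_weight_eq hm h
      exact hw ▸ weight_le_mcgm_pow hmn hp

lemma mcgm_ne_zero {v : Fin n} (h : OnCycle (digraph A) v) : mcgm A ≠ 0 := by
  obtain ⟨m, hm, hp⟩ := onCycle_digraph.1 h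
  have := (pos_of_ne_zero hp).trans_le (pow_le_mcgm_pow v m)
  exact (pow_ne_zero_iff (by omega)).1 this.ne'

lemma exists_pow_eq_mcgm_pow (h : mcgm A ≠ 0) : ∃ m v, 1 ≤ m ∧ pow A m v v = mcgm A ^ m := by
  classical
  by_contra! hne
  have h0 : ⊥ < mcgm A := pos_of_ne_zero h
  refine lt_irrefl (mcgm A) ?_
  conv_lhs => rw [mcgm]
  refine (Finset.sup_lt_iff h0).2 fun k _ => (Finset.sup_lt_iff h0).2 fun p hp => ?_
  obtain ⟨hk, -, hcl⟩ : IsCycle (digraph A) p := by simpa using hp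
  have lt : weight A p < mcgm A ^ k := by
    refine (weight_le_pow p).trans_lt ?_
    rw [← hcl]
    exact lt_of_le_of_ne (pow_le_mcgm_pow _ _) (hne k _ hk)
  rw [one_div]
  exact (NNReal.rpow_inv_lt_iff (by positivity)).2 (by rwa [NNReal.rpow_natCast])

lemma mcgm_lt {c : ℝ≥0} (hc : c ≠ 0) (h : ∀ v m, 1 ≤ m → pow A m v v < c ^ m) : mcgm A < c := by
  rcases eq_or_ne (mcgm A) 0 with h0 | h0
  · exact h0 ▸ pos_of_ne_zero hc
  obtain ⟨m, v, hm, hv⟩ := exists_pow_eq_mcgm_pow h0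
  exact lt_of_pow_lt_pow_left₀ m zero_le (hv ▸ h v m hm)

lemma pow_eq_zero_of_mcgm_eq_zero (h : mcgm A = 0) {t : ℕ} (ht : n ≤ t) (i k : Fin n) :
    pow A t i k = 0 := by
  obtain ⟨v, a, l, b, hl, -, -, -, hle⟩ :=
    exists_pow_le_mul_mul (A := A) one_pos (t := t) (by omega) i k
  have loop : pow A l v v = 0 := by
    simpa [h, hl.ne'] using pow_le_mcgm_pow (A := A) v l
  simpa [loop] using hle

lemma pow_inv_smul_self_le_one {c : ℝ≥0} (h : mcgm A ≤ c) (v : Fin n) (m : ℕ) :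
    pow (c⁻¹ • A) m v v ≤ 1 := by
  rw [pow_smul, Matrix.smul_apply, smul_eq_mul]
  calc c⁻¹ ^ m * pow A m v v ≤ c⁻¹ ^ m * c ^ m :=
        mul_le_mul_right ((pow_le_mcgm_pow v m).trans (pow_le_pow_left' h m)) _
    _ = (c⁻¹ * c) ^ m := (mul_pow _ _ _).symm
    _ ≤ 1 := pow_le_one' (inv_mul_le_one_of_le₀ le_rfl zero_le) m

lemma exists_pow_le_mul_pow {c : ℝ≥0} (hc : c ≠ 0) (h : mcgm A ≤ c) :
    ∃ D, ∀ t i k, pow A t i k ≤ D * c ^ t := by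
  refine ⟨(Finset.range n).sup fun s => Finset.univ.sup fun i => Finset.univ.sup fun k =>
    pow (c⁻¹ • A) s i k, fun t i k => ?_⟩
  obtain ⟨s, hs, -, hle⟩ := exists_short_pow_ge (pow_inv_smul_self_le_one h) one_pos t i k
  rw [pow_smul, Matrix.smul_apply, smul_eq_mul, inv_pow, inv_mul_le_iff₀ (by positivity),
    mul_comm] at hle
  refine hle.trans (mul_le_mul_left ?_ _)
  exact Finset.le_sup_of_le (Finset.mem_range.2 (by omega)) (Finset.le_sup_of_le
    (Finset.mem_univ i) (Finset.le_sup (f := fun k => pow (c⁻¹ • A) s i k) (Finset.mem_univ k)))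

lemma tendsto_pow_of_mcgm_lt_one (h : mcgm A < 1) (i k : Fin n) :
    Tendsto (fun t => pow A t i k) atTop (𝓝 0) := by
  obtain ⟨c, hc, hc1⟩ := exists_between h
  obtain ⟨D, hD⟩ := exists_pow_le_mul_pow (pos_of_gt hc).ne' hc.le
  refine tendsto_of_tendsto_of_tendsto_of_le_of_le tendsto_const_nhds ?_ (fun _ => zero_le)
    fun t => hD t i k
  simpa using (NNReal.tendsto_pow_atTop_nhds_zero_of_lt_one hc1).const_mul D

lemma tendsto_mulVec_pow_of_mcgm_lt_one (h : mcgm A < 1) (y : Fin n → ℝ≥0) (i : Fin n) :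
    Tendsto (fun t => mulVec (pow A t) y i) atTop (𝓝 0) := by
  have entry : ∀ k ∈ Finset.univ, Tendsto (fun t => pow A t i k * y k) atTop (𝓝 0) :=
    fun k _ => by simpa using (tendsto_pow_of_mcgm_lt_one h i k).mul_const (y k)
  have bot : Finset.univ.sup (fun _ : Fin n => (0 : ℝ≥0)) = 0 := Finset.sup_bot _
  exact bot ▸ Tendsto.finset_sup_nhds_apply entry

lemma HasPath.of_criticalDigraph {m : ℕ} {i j : Fin n} (h : HasPath (criticalDigraph A) m i j) :
    HasPath (digraph A) m i j := by
  obtain ⟨p, hp, h0, hm⟩ := h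
  refine ⟨p, fun s => ?_, h0, hm⟩
  obtain ⟨k, p', hp', -, s', h, h'⟩ := hp s
  exact h ▸ h' ▸ hp'.2.1 s'

lemma exists_return_of_criticalDigraph_adj {a b : Fin n} (h : (criticalDigraph A).Adj a b) :
    ∃ r, mcgm A ^ (1 + r) ≤ A a b * pow A r b a := by
  obtain ⟨k, p, ⟨hk, -, hcl⟩, hw, s, rfl, rfl⟩ := h
  obtain ⟨q, rfl⟩ := exists_eq_seq_coe p
  rw [rpow_one_div_natCast_eq_iff hk, weight_eq_seqWeight] at hw
  replace hcl : q 0 = q k := hcl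
  refine ⟨k - (s + 1) + s, ?_⟩
  calc mcgm A ^ (1 + (k - (s + 1) + s)) = seqWeight A q 0 k := by rw [hw]; congr 1; omega
    _ = seqWeight A q 0 s * A (q s) (q (s + 1)) * seqWeight A q (s + 1) k := by
      rw [← seqWeight_mul q (Nat.zero_le (s + 1)) s.2, seqWeight,
        Finset.prod_Ico_succ_top s.1.zero_le, ← seqWeight]
    _ = A (q s) (q (s + 1)) * (seqWeight A q (s + 1) k * seqWeight A q 0 s) := by ring
    _ ≤ A (q s) (q (s + 1)) *
        (pow A (k - (s + 1)) (q (s + 1)) (q k) * pow A s (q k) (q s)) := by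
      gcongr
      · exact seqWeight_le q s.2
      · exact hcl ▸ seqWeight_le q s.1.zero_le
    _ ≤ A (q s) (q (s + 1)) * pow A (k - (s + 1) + s) (q (s + 1)) (q s) := by
      gcongr
      exact pow_add_le _ _ _ _ _

lemma exists_return_of_hasPath_criticalDigraph {m : ℕ} {a b : Fin n}
    (h : HasPath (criticalDigraph A) m a b) :
    ∃ r, mcgm A ^ (m + r) ≤ pow A m a b * pow A r b a := by
  induction m generalizing b with
  | zero =>
    obtain rfl := hasPath_zero.1 h
    exact ⟨0, by simp [pow_zero_self]⟩
  | succ m ih =>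
    obtain ⟨l, hl, hlb⟩ := hasPath_succ.1 h
    obtain ⟨r, hr⟩ := ih hl
    obtain ⟨r', hr'⟩ := exists_return_of_criticalDigraph_adj hlb
    refine ⟨r' + r, ?_⟩
    calc mcgm A ^ (m + 1 + (r' + r)) = mcgm A ^ (m + r) * mcgm A ^ (1 + r') := by ring
      _ ≤ (pow A m a l * pow A r l a) * (A l b * pow A r' b l) := mul_le_mul' hr hr'
      _ = (pow A m a l * A l b) * (pow A r' b l * pow A r l a) := by ring
      _ ≤ pow A (m + 1) a b * pow A (r' + r) b a :=
        mul_le_mul' (le_mul_apply _ _ _ _ _) (pow_add_le _ _ _ _ _)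

/-- A closed path of the critical digraph may combine edges of several critical cycles; returning
along the rest of these cycles shows that it still has geometric mean `mcgm A`. -/
lemma pow_eq_of_hasPath_criticalDigraph {m : ℕ} {v : Fin n}
    (h : HasPath (criticalDigraph A) m v v) : pow A m v v = mcgm A ^ m := by
  rcases Nat.eq_zero_or_pos m with rfl | hm
  · simp [pow_zero_self]
  have h0 : mcgm A ≠ 0 := mcgm_ne_zero ⟨m, hm, h.of_criticalDigraph⟩
  refine le_antisymm (pow_le_mcgm_pow _ _) ?_
  obtain ⟨r, hr⟩ := exists_return_of_hasPath_criticalDigraph h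
  refine le_of_mul_le_mul_right ?_ (pos_of_ne_zero (pow_ne_zero r h0))
  calc mcgm A ^ m * mcgm A ^ r = mcgm A ^ (m + r) := (pow_add _ _ _).symm
    _ ≤ pow A m v v * pow A r v v := hr
    _ ≤ pow A m v v * mcgm A ^ r := mul_le_mul' le_rfl (pow_le_mcgm_pow _ _)

lemma hasPath_criticalDigraph {m : ℕ} (hm : 1 ≤ m) {v : Fin n} (h0 : mcgm A ≠ 0)
    (h : pow A m v v = mcgm A ^ m) : HasPath (criticalDigraph A) m v v := by
  obtain ⟨p, hp, hw, hv⟩ := exists_isCycle_weight_eq hm (h ▸ pow_ne_zero m h0)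
  exact ⟨p, fun s => ⟨m, p, hp, (rpow_one_div_natCast_eq_iff hm).2 (hw.trans h), s, rfl, rfl⟩, hv,
    hp.2.2.symm.trans hv⟩

lemma componentMatrix_eq_restrict (i : Fin n) :
    componentMatrix A i = restrict A {k | SameComponent (digraph A) i k} := rfl

lemma nodeMcgm_congr {i j : Fin n} (h : SameComponent (digraph A) i j) :
    nodeMcgm A i = nodeMcgm A j := by
  have same : {k | SameComponent (digraph A) i k} = {k | SameComponent (digraph A) j k} :=
    Set.ext fun k => ⟨h.symm.trans, h.trans⟩
  rw [nodeMcgm, nodeMcgm, componentMatrix_eq_restrict, componentMatrix_eq_restrict, same]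

lemma pow_componentMatrix {i v : Fin n} (h : SameComponent (digraph A) i v) (m : ℕ) :
    pow (componentMatrix A i) m v v = pow A m v v :=
  pow_restrict_eq (fun _ hu hu' => h.trans ⟨hu, hu'⟩) m

lemma pow_le_nodeMcgm_pow (v : Fin n) (m : ℕ) : pow A m v v ≤ nodeMcgm A v ^ m := by
  rw [← pow_componentMatrix (.refl v)]
  exact pow_le_mcgm_pow v m

lemma nodeMcgm_ne_zero {v : Fin n} (h : OnCycle (digraph A) v) : nodeMcgm A v ≠ 0 := by
  refine mcgm_ne_zero (v := v) (onCycle_digraph.2 ?_)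
  simpa only [pow_componentMatrix (.refl v)] using onCycle_digraph.1 h

lemma exists_pow_eq_nodeMcgm_pow {v : Fin n} (h : nodeMcgm A v ≠ 0) :
    ∃ c m, SameComponent (digraph A) v c ∧ 1 ≤ m ∧ pow A m c c = nodeMcgm A v ^ m := by
  obtain ⟨m, c, hm, hc⟩ := exists_pow_eq_mcgm_pow h
  have hs : SameComponent (digraph A) v c := by
    by_contra hne
    rw [componentMatrix_eq_restrict, pow_restrict_of_notMem_right hm hne] at hc
    exact pow_ne_zero m h hc.symm
  exact ⟨c, m, hs, hm, (pow_componentMatrix hs m).symm.trans hc⟩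

lemma jointCyclicity_pos (A : Matrix (Fin n) (Fin n) ℝ≥0) : 0 < jointCyclicity A := by
  rw [Nat.pos_iff_ne_zero, jointCyclicity, Finset.lcm_ne_zero_iff]
  exact fun _ _ => cyclicity_ne_zero

lemma eventually_pow_eq_nodeMcgm_pow {v : Fin n} (h0 : nodeMcgm A v ≠ 0) {m : ℕ} (hm : 1 ≤ m)
    (h : pow A m v v = nodeMcgm A v ^ m) :
    ∀ᶠ t in atTop, jointCyclicity A ∣ t → pow A t v v = nodeMcgm A v ^ t := by
  rw [← pow_componentMatrix (.refl v)] at h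
  have hv : OnCycle (criticalDigraph (componentMatrix A v)) v :=
    ⟨m, hm, hasPath_criticalDigraph hm h0 h⟩
  have hdvd : period (criticalDigraph (componentMatrix A v)) v ∣ jointCyclicity A :=
    hv.period_dvd_cyclicity.trans (Finset.dvd_lcm
      (f := fun i => cyclicity (criticalDigraph (componentMatrix A i))) (Finset.mem_univ v))
  filter_upwards [eventually_hasPath_of_period_dvd v] with t ht hγ
  rw [← pow_componentMatrix (.refl v)]
  exact pow_eq_of_hasPath_criticalDigraph (ht (hdvd.trans hγ))

end CycleMeans

/-! ### Ultimate periodicity -/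

section Periodicity

variable {n : ℕ} {A : Matrix (Fin n) (Fin n) ℝ≥0}

open Classical in
/-- The part of `A ^ t ⊗ y` that comes from paths through the set `C`. -/
noncomputable def throughVec (A : Matrix (Fin n) (Fin n) ℝ≥0) (C : Set (Fin n))
    (y : Fin n → ℝ≥0) (t : ℕ) : Fin n → ℝ≥0 := fun i =>
  (Finset.univ.filter (· ∈ C) ×ˢ Finset.HasAntidiagonal.antidiagonal t).sup fun x =>
    pow A x.2.1 i x.1 * mulVec (pow A x.2.2) y x.1

lemma throughVec_le_iff {C : Set (Fin n)} {y : Fin n → ℝ≥0} {t : ℕ} {i : Fin n} {c : ℝ≥0} :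
    throughVec A C y t i ≤ c ↔
      ∀ v ∈ C, ∀ a b, a + b = t → pow A a i v * mulVec (pow A b) y v ≤ c := by
  simp only [throughVec, Finset.sup_le_iff, Prod.forall, Finset.mem_product, Finset.mem_filter,
    Finset.mem_univ, true_and, Finset.HasAntidiagonal.mem_antidiagonal, and_imp]
  exact forall_congr' fun v => ⟨fun h hv a b => h a b hv, fun h a b hv => h hv a b⟩

lemma le_throughVec {C : Set (Fin n)} {v : Fin n} (hv : v ∈ C) (y : Fin n → ℝ≥0) (a b : ℕ)
    (i : Fin n) : pow A a i v * mulVec (pow A b) y v ≤ throughVec A C y (a + b) i :=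
  throughVec_le_iff.1 le_rfl v hv a b rfl

lemma throughVec_le_mulVec (C : Set (Fin n)) (y : Fin n → ℝ≥0) (t : ℕ) (i : Fin n) :
    throughVec A C y t i ≤ mulVec (pow A t) y i :=
  throughVec_le_iff.2 fun v _ a b hab => hab ▸ pow_mul_mulVec_le a b y i v

lemma throughVec_ne_zero {C : Set (Fin n)} {y : Fin n → ℝ≥0} {t : ℕ} {i : Fin n}
    (h : HasPathThrough (digraph A) C (Function.support y) t i) : throughVec A C y t i ≠ 0 := by
  obtain ⟨v, hv, k, hk, a, b, rfl, hiv, hvk⟩ := h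
  have hpos := pos_of_ne_zero
    (mul_ne_zero (hasPath_digraph.1 hiv) (mulVec_pow_ne_zero.2 ⟨k, hk, hvk⟩))
  exact (hpos.trans_le (le_throughVec hv y a b i)).ne'

lemma mulVec_pow_le_throughVec_or (C : Set (Fin n)) (y : Fin n → ℝ≥0) (t : ℕ) (i : Fin n) :
    mulVec (pow A t) y i ≤ throughVec A C y t i ∨
      mulVec (pow A t) y i ≤ mulVec (pow (restrict A Cᶜ) t) y i := by
  obtain ⟨k, hk⟩ := exists_mulVec_apply (pow A t) y i
  rw [hk]
  rcases pow_le_pow_restrict_or Cᶜ t i k with h | ⟨v, hv, a, b, rfl, h⟩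
  · exact .inr ((mul_le_mul_left h _).trans (le_mulVec_apply _ _ _ _))
  · left
    calc pow A (a + b) i k * y k ≤ pow A a i v * pow A b v k * y k := mul_le_mul_left h _
      _ = pow A a i v * (pow A b v k * y k) := mul_assoc _ _ _
      _ ≤ pow A a i v * mulVec (pow A b) y v := by gcongr; exact le_mulVec_apply _ _ _ _
      _ ≤ throughVec A C y (a + b) i := le_throughVec (not_not.1 hv) y a b i

/-- A path through `v ∈ C` is shortened on both sides of `v`, and then lengthened by a closed path
of weight `1` through `v`. -/
lemma eventually_throughVec_le (hA : ∀ v m, pow A m v v ≤ 1) {C : Set (Fin n)} {N : ℕ}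
    (hN : 0 < N) (hC : ∀ᶠ t in atTop, N ∣ t → ∀ v ∈ C, pow A t v v = 1) (y : Fin n → ℝ≥0) :
    ∀ᶠ s in atTop, ∀ t, t ≡ s [MOD N] → throughVec A C y t ≤ throughVec A C y s := by
  obtain ⟨T, hT⟩ := eventually_atTop.1 hC
  filter_upwards [eventually_ge_atTop (T + n * N + n * N)] with s hs t hts i
  refine throughVec_le_iff.2 fun v hv a b hab => ?_
  obtain ⟨a', ha', haa', hlea⟩ := exists_short_pow_ge hA hN a i v
  obtain ⟨b', hb', hbb', hleb⟩ := exists_short_mulVec_pow_ge hA hN b y v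
  obtain ⟨m, rfl⟩ := Nat.exists_eq_add_of_le (show a' + b' ≤ s by omega)
  have hNm : N ∣ m := by
    have : a' + b' + 0 ≡ a' + b' + m [MOD N] := (hab ▸ haa'.add hbb').trans hts
    exact (Nat.modEq_zero_iff_dvd.1 (Nat.ModEq.add_left_cancel' _ this).symm)
  calc pow A a i v * mulVec (pow A b) y v
      ≤ pow A a' i v * (pow A m v v * mulVec (pow A b') y v) := by
        rw [hT m (by omega) hNm v hv, one_mul]
        exact mul_le_mul' hlea hleb
    _ ≤ pow A a' i v * mulVec (pow A (m + b')) y v := by gcongr; exact pow_mul_mulVec_le _ _ _ _ _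
    _ ≤ throughVec A C y (a' + (m + b')) i := le_throughVec hv y _ _ i
    _ = throughVec A C y (a' + b' + m) i := by rw [add_comm m, add_assoc]

lemma eventually_throughVec_add_eq (hA : ∀ v m, pow A m v v ≤ 1) {C : Set (Fin n)} {N : ℕ}
    (hN : 0 < N) (hC : ∀ᶠ t in atTop, N ∣ t → ∀ v ∈ C, pow A t v v = 1) (y : Fin n → ℝ≥0) :
    ∀ᶠ t in atTop, throughVec A C y (t + N) = throughVec A C y t := by
  have hle := eventually_throughVec_le hA hN hC y
  filter_upwards [hle, (tendsto_add_atTop_nat N).eventually hle] with t ht htN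
  have hmod : t + N ≡ t [MOD N] := Nat.add_mod_right t N
  exact le_antisymm (ht _ hmod) (htN _ hmod.symm)

lemma exists_pos_eventually_le_of_ne_zero {ι : Type*} [Finite ι] {f : ℕ → ι → ℝ≥0} {N : ℕ}
    (hN : 0 < N) (hf : ∀ᶠ t in atTop, f (t + N) = f t) :
    ∃ c, 0 < c ∧ ∀ᶠ t in atTop, ∀ i, f t i ≠ 0 → c ≤ f t i := by
  obtain ⟨T, hT⟩ := eventually_atTop.1 hf
  have periodic : Function.Periodic (fun t => f (T + t)) N := fun t => by
    simpa only [add_assoc] using hT (T + t) (by omega)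
  have small : ∀ᶠ c in 𝓝[>] (0 : ℝ≥0), ∀ (s : Fin N) (i : ι),
      f (T + s) i ≠ 0 → c ≤ f (T + s) i := by
    refine eventually_all.2 fun s => eventually_all.2 fun i => ?_
    rcases eq_or_ne (f (T + s) i) 0 with h | h
    · exact .of_forall fun c hc => (hc h).elim
    · filter_upwards [nhdsWithin_le_nhds (ge_mem_nhds (pos_of_ne_zero h))] with c hc _ using hc
  obtain ⟨c, hc, hpos⟩ := (small.and self_mem_nhdsWithin).exists
  refine ⟨c, hpos, eventually_atTop.2 ⟨T, fun t ht i => ?_⟩⟩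
  obtain ⟨s, rfl⟩ := Nat.exists_eq_add_of_le ht
  have reduce : f (T + s % N) = f (T + s) := periodic.map_mod_nat s
  exact reduce ▸ hc ⟨s % N, Nat.mod_lt s hN⟩ i

/-- Paths avoiding `C` have weights tending to `0`, whereas the orbit is bounded below on the nodes
where it does not vanish; so for large `t` only the paths through `C` matter. -/
lemma eventually_mulVec_pow_eq_throughVec (hA : ∀ v m, pow A m v v ≤ 1) {C : Set (Fin n)} {N : ℕ}
    (hN : 0 < N) (hC : ∀ᶠ t in atTop, N ∣ t → ∀ v ∈ C, pow A t v v = 1)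
    (hC' : ∀ v ∉ C, ∀ m, 1 ≤ m → pow A m v v < 1) {y : Fin n → ℝ≥0}
    (hy : ∀ᶠ t in atTop, ∀ i, mulVec (pow A t) y i ≠ 0 →
      HasPathThrough (digraph A) C (Function.support y) t i) :
    ∀ᶠ t in atTop, mulVec (pow A t) y = throughVec A C y t := by
  obtain ⟨c, hc, hle⟩ :=
    exists_pos_eventually_le_of_ne_zero hN (eventually_throughVec_add_eq hA hN hC y)
  have hlt : mcgm (restrict A Cᶜ) < 1 := by
    refine mcgm_lt one_ne_zero fun v m hm => ?_
    rw [one_pow]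
    by_cases hv : v ∈ C
    · rw [pow_restrict_of_notMem_right hm (not_not.2 hv)]
      exact one_pos
    · exact (pow_restrict_le _ m v v).trans_lt (hC' v hv m hm)
  have avoiding : ∀ᶠ t in atTop, ∀ i, mulVec (pow (restrict A Cᶜ) t) y i < c :=
    eventually_all.2 fun i => (tendsto_mulVec_pow_of_mcgm_lt_one hlt y i).eventually_lt_const hc
  filter_upwards [hle, avoiding, hy] with t hle hav hy
  funext i
  refine le_antisymm ?_ (throughVec_le_mulVec C y t i)
  rcases eq_or_ne (mulVec (pow A t) y i) 0 with h | h
  · exact h ▸ zero_le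
  rcases mulVec_pow_le_throughVec_or C y t i with h' | h'
  · exact h'
  · exact h'.trans ((hav i).le.trans (hle i (throughVec_ne_zero (hy i h))))

lemma eventually_mulVec_pow_add_eq (hA : ∀ v m, pow A m v v ≤ 1) {C : Set (Fin n)} {N : ℕ}
    (hN : 0 < N) (hC : ∀ᶠ t in atTop, N ∣ t → ∀ v ∈ C, pow A t v v = 1)
    (hC' : ∀ v ∉ C, ∀ m, 1 ≤ m → pow A m v v < 1) {y : Fin n → ℝ≥0}
    (hy : ∀ᶠ t in atTop, ∀ i, mulVec (pow A t) y i ≠ 0 →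
      HasPathThrough (digraph A) C (Function.support y) t i) :
    ∀ᶠ t in atTop, mulVec (pow A (t + N)) y = mulVec (pow A t) y := by
  have heq := eventually_mulVec_pow_eq_throughVec hA hN hC hC' hy
  filter_upwards [heq, (tendsto_add_atTop_nat N).eventually heq,
    eventually_throughVec_add_eq hA hN hC y] with t eq_t eq_add periodic
  rw [eq_t, eq_add, periodic]

/-- The critical nodes: those on closed paths of geometric mean `mcgm A`. Used only for
`mcgm A ≠ 0`: otherwise the nodes that lie on no cycle satisfy the equation with both sides `0`. -/
def criticalNodes (A : Matrix (Fin n) (Fin n) ℝ≥0) : Set (Fin n) :=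
  {v | ∃ m, 1 ≤ m ∧ pow A m v v = mcgm A ^ m}

theorem eventually_mulVec_pow_add_eq_smul (h0 : mcgm A ≠ 0) {N : ℕ} (hN : 0 < N)
    (hA : ∀ᶠ t in atTop, N ∣ t → ∀ v ∈ criticalNodes A, pow A t v v = mcgm A ^ t)
    {y : Fin n → ℝ≥0} (hy : ∀ᶠ t in atTop, ∀ i, mulVec (pow A t) y i ≠ 0 →
      HasPathThrough (digraph A) (criticalNodes A) (Function.support y) t i) :
    ∀ᶠ t in atTop, mulVec (pow A (t + N)) y = mcgm A ^ N • mulVec (pow A t) y := by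
  set μ := mcgm A
  have hinv : μ⁻¹ ≠ 0 := inv_ne_zero h0
  have scale : ∀ t v, pow (μ⁻¹ • A) t v v = (μ ^ t)⁻¹ * pow A t v v := fun t v => by
    rw [pow_smul, inv_pow, Matrix.smul_apply, smul_eq_mul]
  have normalized := eventually_mulVec_pow_add_eq (A := μ⁻¹ • A) (C := criticalNodes A) (y := y)
    (pow_inv_smul_self_le_one le_rfl) hN
    (hA.mono fun t ht hNt v hv => by
      rw [scale, ht hNt v hv, inv_mul_cancel₀ (pow_ne_zero t h0)])
    (fun v hv m hm => by
      rw [scale, inv_mul_lt_one₀ (by positivity)]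
      exact lt_of_le_of_ne (pow_le_mcgm_pow v m) fun h => hv ⟨m, hm, h⟩)
    (by
      rw [digraph_smul hinv]
      refine hy.mono fun t ht i hi => ht i fun h => hi ?_
      rw [pow_smul, smul_mulVec, Pi.smul_apply, h, smul_zero])
  filter_upwards [normalized] with t ht
  rw [pow_smul, pow_smul, smul_mulVec, smul_mulVec, inv_pow, inv_pow] at ht
  rw [inv_smul_eq_iff₀ (pow_ne_zero _ h0)] at ht
  rw [ht, smul_smul, pow_add, mul_right_comm, mul_inv_cancel₀ (pow_ne_zero t h0), one_mul]

end Periodicity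

/-! ### Sufficiency -/

section Sufficiency

variable {n : ℕ} {A : Matrix (Fin n) (Fin n) ℝ≥0}

/-- The part of `A` carried by the nodes that access the set `S`. -/
noncomputable def accessingMatrix (A : Matrix (Fin n) (Fin n) ℝ≥0) (S : Set (Fin n)) :
    Matrix (Fin n) (Fin n) ℝ≥0 :=
  restrict A (accessingNodes (digraph A) S)

lemma pow_accessingMatrix {S : Set (Fin n)} {j : Fin n}
    (hj : j ∈ accessingNodes (digraph A) S) (t : ℕ) (i : Fin n) :
    pow (accessingMatrix A S) t i j = pow A t i j :=
  pow_restrict_eq (fun _ _ hvj => hvj.mem_accessingNodes hj) t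

lemma mulVec_pow_accessingMatrix (y : Fin n → ℝ≥0) (t : ℕ) :
    mulVec (pow (accessingMatrix A (Function.support y)) t) y = mulVec (pow A t) y := by
  funext i
  refine Finset.sup_congr rfl fun k _ => ?_
  rcases eq_or_ne (y k) 0 with hk | hk
  · rw [hk, mul_zero, mul_zero]
  · rw [pow_accessingMatrix (subset_accessingNodes _ hk)]

lemma HasPathThrough.accessingMatrix {C S : Set (Fin n)} {t : ℕ} {i : Fin n}
    (h : HasPathThrough (digraph A) C S t i) :
    HasPathThrough (digraph (accessingMatrix A S)) C S t i := by
  obtain ⟨v, hv, k, hk, a, b, hab, hiv, hvk⟩ := h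
  refine ⟨v, hv, k, hk, a, b, hab, ?_, ?_⟩ <;> rw [hasPath_digraph, pow_accessingMatrix]
  · exact hasPath_digraph.1 hiv
  · exact ⟨k, hk, b, hvk⟩
  · exact hasPath_digraph.1 hvk
  · exact subset_accessingNodes _ hk

lemma mem_criticalNodes_accessingMatrix {S : Set (Fin n)} {v : Fin n}
    (h0 : mcgm (accessingMatrix A S) ≠ 0) :
    v ∈ criticalNodes (accessingMatrix A S) ↔
      v ∈ accessingNodes (digraph A) S ∧
        ∃ m, 1 ≤ m ∧ pow A m v v = mcgm (accessingMatrix A S) ^ m := by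
  constructor
  · rintro ⟨m, hm, hv⟩
    have hvS : v ∈ accessingNodes (digraph A) S := by
      by_contra hvS
      rw [accessingMatrix, pow_restrict_of_notMem_right hm hvS] at hv
      exact pow_ne_zero m h0 hv.symm
    exact ⟨hvS, m, hm, by rw [← hv, pow_accessingMatrix hvS]⟩
  · rintro ⟨hvS, m, hm, hv⟩
    exact ⟨m, hm, by rw [← hv, pow_accessingMatrix hvS]⟩

lemma nodeMcgm_le_mcgm_accessingMatrix {S : Set (Fin n)} {v : Fin n}
    (hv : v ∈ accessingNodes (digraph A) S) : nodeMcgm A v ≤ mcgm (accessingMatrix A S) := by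
  rcases eq_or_ne (nodeMcgm A v) 0 with h | h
  · exact h ▸ zero_le
  obtain ⟨c, m, hvc, hm, hc⟩ := exists_pow_eq_nodeMcgm_pow h
  rw [← pow_accessingMatrix (hvc.2.mem_accessingNodes hv)] at hc
  exact le_of_pow_le_pow_left₀ (by omega) zero_le (hc ▸ pow_le_mcgm_pow c m)

lemma nodeMcgm_eq_of_mem_criticalNodes {S : Set (Fin n)} {v : Fin n}
    (h0 : mcgm (accessingMatrix A S) ≠ 0) (hv : v ∈ criticalNodes (accessingMatrix A S)) :
    nodeMcgm A v = mcgm (accessingMatrix A S) := by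
  obtain ⟨hvS, m, hm, h⟩ := (mem_criticalNodes_accessingMatrix h0).1 hv
  exact le_antisymm (nodeMcgm_le_mcgm_accessingMatrix hvS)
    (le_of_pow_le_pow_left₀ (by omega) zero_le (h ▸ pow_le_nodeMcgm_pow v m))

lemma onCycle_of_mem_criticalNodes {S : Set (Fin n)} {v : Fin n}
    (h0 : mcgm (accessingMatrix A S) ≠ 0) (hv : v ∈ criticalNodes (accessingMatrix A S)) :
    OnCycle (digraph A) v := by
  obtain ⟨-, m, hm, h⟩ := (mem_criticalNodes_accessingMatrix h0).1 hv
  exact onCycle_digraph.2 ⟨m, hm, h ▸ pow_ne_zero m h0⟩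

lemma eventually_pow_eq_of_mem_criticalNodes {S : Set (Fin n)}
    (h0 : mcgm (accessingMatrix A S) ≠ 0) :
    ∀ᶠ t in atTop, jointCyclicity A ∣ t → ∀ v ∈ criticalNodes (accessingMatrix A S),
      pow (accessingMatrix A S) t v v = mcgm (accessingMatrix A S) ^ t := by
  have each : ∀ v, ∀ᶠ t in atTop, v ∈ criticalNodes (accessingMatrix A S) →
      jointCyclicity A ∣ t → pow (accessingMatrix A S) t v v = mcgm (accessingMatrix A S) ^ t := by
    intro v
    by_cases hv : v ∈ criticalNodes (accessingMatrix A S)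
    · obtain ⟨hvS, m, hm, h⟩ := (mem_criticalNodes_accessingMatrix h0).1 hv
      have hμ := nodeMcgm_eq_of_mem_criticalNodes h0 hv
      rw [← hμ] at h
      filter_upwards [eventually_pow_eq_nodeMcgm_pow (hμ.trans_ne h0) hm h] with t ht _ hγ
      rw [pow_accessingMatrix hvS, ht hγ, hμ]
    · exact .of_forall fun t hv' => (hv hv').elim
  filter_upwards [eventually_all.2 each] with t ht hγ v hv using ht v hv hγ

/-- By monotonicity, a cyclic node that reaches `S` either has the largest `λ` among such nodes, so
that its own component is critical, or strongly accesses every critical node. -/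
lemma exists_mem_criticalNodes_accessingMatrix {S : Set (Fin n)}
    (h0 : mcgm (accessingMatrix A S) ≠ 0)
    (mono : ∀ i j, OnCycle (digraph A) i → OnCycle (digraph A) j → Accesses (digraph A) i j →
      nodeMcgm A i ≤ nodeMcgm A j)
    (eq_of_not : ∀ i j, OnCycle (digraph A) i → OnCycle (digraph A) j →
      ¬ StronglyAccesses (digraph A) j i → ¬ StronglyAccesses (digraph A) i j →
      nodeMcgm A i = nodeMcgm A j)
    {l : Fin n} (hlS : l ∈ accessingNodes (digraph A) S) (hl : OnCycle (digraph A) l) :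
    ∃ v ∈ criticalNodes (accessingMatrix A S),
      SameComponent (digraph A) l v ∨ StronglyAccesses (digraph A) l v := by
  rcases (nodeMcgm_le_mcgm_accessingMatrix hlS).eq_or_lt with hle | hlt
  · obtain ⟨c, m, hlc, hm, hc⟩ := exists_pow_eq_nodeMcgm_pow (nodeMcgm_ne_zero hl)
    refine ⟨c, (mem_criticalNodes_accessingMatrix h0).2 ⟨hlc.2.mem_accessingNodes hlS, m, hm, ?_⟩,
      .inl hlc⟩
    rw [hc, hle]
  · obtain ⟨m, v, hm, hvm⟩ := exists_pow_eq_mcgm_pow h0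
    have hv : v ∈ criticalNodes (accessingMatrix A S) := ⟨m, hm, hvm⟩
    have hvc := onCycle_of_mem_criticalNodes h0 hv
    rw [← nodeMcgm_eq_of_mem_criticalNodes h0 hv] at hlt
    refine ⟨v, hv, .inr ?_⟩
    by_contra hlv
    exact hlt.ne (eq_of_not l v hl hvc (fun hvl => (mono v l hvc hl hvl.accesses).not_gt hlt) hlv)

theorem orbitPeriodic_of_conditions
    (h : ∀ i j, OnCycle (digraph A) i → OnCycle (digraph A) j →
      (Accesses (digraph A) i j → nodeMcgm A i ≤ nodeMcgm A j) ∧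
      (¬ StronglyAccesses (digraph A) j i ∧ ¬ StronglyAccesses (digraph A) i j →
        nodeMcgm A i = nodeMcgm A j)) : OrbitPeriodic A := by
  intro y
  set S := Function.support y
  set B := accessingMatrix A S
  have orbit : ∀ t, mulVec (pow B t) y = mulVec (pow A t) y :=
    mulVec_pow_accessingMatrix y
  rw [UltimatelyLinearPeriodic]
  simp only [← orbit]
  rcases eq_or_ne (mcgm B) 0 with h0 | h0
  · have vanish : ∀ t, n ≤ t → mulVec (pow B t) y = 0 := fun t ht => by
      funext i
      obtain ⟨k, hk⟩ := exists_mulVec_apply (pow B t) y i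
      rw [hk, pow_eq_zero_of_mcgm_eq_zero h0 ht, zero_mul, Pi.zero_apply]
    exact ⟨0, n, fun t ht => by rw [vanish t ht, vanish _ (by omega), smul_zero]⟩
  have critical_access : criticalNodes B ⊆ accessingNodes (digraph A) S :=
    fun v hv => ((mem_criticalNodes_accessingMatrix h0).1 hv).1
  have through : ∀ᶠ t in atTop, ∀ i, mulVec (pow B t) y i ≠ 0 →
      HasPathThrough (digraph B) (criticalNodes B) S t i := by
    filter_upwards [eventually_hasPathThrough critical_access fun l =>
      exists_mem_criticalNodes_accessingMatrix h0 (fun i j hi hj => (h i j hi hj).1)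
        fun i j hi hj hji hij => (h i j hi hj).2 ⟨hji, hij⟩] with t ht i hi
    exact (ht i (mulVec_pow_ne_zero.1 (orbit t ▸ hi))).accessingMatrix
  exact ⟨mcgm B, eventually_atTop.1 (eventually_mulVec_pow_add_eq_smul h0 (jointCyclicity_pos A)
    (eventually_pow_eq_of_mem_criticalNodes h0) through)⟩

end Sufficiency

/-! ### Necessity -/

section Necessity

variable {n : ℕ} {A : Matrix (Fin n) (Fin n) ℝ≥0}

lemma mulVec_sup (A : Matrix (Fin n) (Fin n) ℝ≥0) (y z : Fin n → ℝ≥0) :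
    mulVec A (y ⊔ z) = mulVec A y ⊔ mulVec A z := by
  funext i
  simp only [mulVec, Pi.sup_apply, mul_max]
  exact Finset.sup_sup

lemma mulVec_unitVec (A : Matrix (Fin n) (Fin n) ℝ≥0) (i u : Fin n) :
    mulVec A (unitVec i) u = A u i := by
  refine le_antisymm (Finset.sup_le fun k _ => ?_) ?_
  · rcases eq_or_ne k i with rfl | hk
    · simp [unitVec]
    · simp [unitVec, hk]
  · simpa [unitVec] using le_mulVec_apply A (unitVec i) u i

lemma unitVec_sup_left_ne_zero (i j : Fin n) : (unitVec i ⊔ unitVec j : Fin n → ℝ≥0) i ≠ 0 := by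
  have le : (1 : ℝ≥0) ≤ (unitVec i ⊔ unitVec j : Fin n → ℝ≥0) i :=
    le_sup_of_le_left (Pi.single_eq_same (M := fun _ => ℝ≥0) i 1).ge
  exact (zero_lt_one.trans_le le).ne'

lemma mulVec_pow_add_mul_eq {y : Fin n → ℝ≥0} {r : ℝ≥0} {N T : ℕ}
    (h : ∀ t, T ≤ t → mulVec (pow A (t + N)) y = r ^ N • mulVec (pow A t) y) {t : ℕ} (ht : T ≤ t)
    (k : ℕ) : mulVec (pow A (t + k * N)) y = r ^ (k * N) • mulVec (pow A t) y := by
  induction k with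
  | zero => simp
  | succ k ih =>
    rw [Nat.succ_mul, ← add_assoc, h _ (by omega), ih, smul_smul, ← pow_add, add_comm N]

lemma nodeMcgm_le_of_accesses_support {y : Fin n → ℝ≥0} {r : ℝ≥0} {N T : ℕ} (hN : 0 < N)
    (h : ∀ t, T ≤ t → mulVec (pow A (t + N)) y = r ^ N • mulVec (pow A t) y) {i k : Fin n}
    (hk : y k ≠ 0) (hik : Accesses (digraph A) i k) : nodeMcgm A i ≤ r := by
  rcases eq_or_ne (nodeMcgm A i) 0 with h0 | h0
  · exact h0 ▸ zero_le
  obtain ⟨c, m, hic, hm, hc⟩ := exists_pow_eq_nodeMcgm_pow h0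
  obtain ⟨p, hp⟩ := hic.2.trans hik
  have loop : HasPath (digraph A) m c c := hasPath_digraph.2 (hc ▸ pow_ne_zero m h0)
  set t := T * m + p
  have hTt : T ≤ t := le_add_right (Nat.le_mul_of_pos_right T hm)
  have x_ne : mulVec (pow A t) y c ≠ 0 := mulVec_pow_ne_zero.2 ⟨k, hk, (loop.mul_left T).trans hp⟩
  refine le_of_pow_le_pow_left₀ (mul_pos hm hN).ne' zero_le
    (le_of_mul_le_mul_right ?_ (pos_of_ne_zero x_ne))
  calc nodeMcgm A i ^ (m * N) * mulVec (pow A t) y c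
      = pow A m c c ^ N * mulVec (pow A t) y c := by rw [pow_mul, hc]
    _ ≤ pow A (N * m) c c * mulVec (pow A t) y c := by gcongr; exact pow_self_pow_le m N c
    _ ≤ mulVec (pow A (N * m + t)) y c := pow_mul_mulVec_le _ _ _ _ _
    _ = r ^ (m * N) * mulVec (pow A t) y c := by
      rw [add_comm, mul_comm N, mulVec_pow_add_mul_eq h hTt, Pi.smul_apply, smul_eq_mul]

lemma le_of_forall_pow_mul_le {a b x c : ℝ≥0} (hx : x ≠ 0) (h : ∀ k, a ^ k * x ≤ b ^ k * c) :
    a ≤ b := by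
  by_contra! hba
  have ha : 0 < a := pos_of_gt hba
  have lim : Tendsto (fun k => (b / a) ^ k * c) atTop (𝓝 0) := by
    simpa using (NNReal.tendsto_pow_atTop_nhds_zero_of_lt_one
      ((div_lt_one ha).2 hba)).mul_const c
  refine hx (nonpos_iff_eq_zero.1 (ge_of_tendsto' lim fun k => ?_))
  rw [div_pow, div_mul_eq_mul_div, le_div_iff₀ (pow_pos ha k), mul_comm]
  exact h k

lemma le_nodeMcgm_of_mulVec_pow_le {y : Fin n → ℝ≥0} {r : ℝ≥0} {N T : ℕ} (hN : 0 < N)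
    (h : ∀ t, T ≤ t → mulVec (pow A (t + N)) y = r ^ N • mulVec (pow A t) y) {i : Fin n}
    (hi : OnCycle (digraph A) i) (hyi : y i ≠ 0)
    (hle : ∀ t, HasPath (digraph A) t i i → mulVec (pow A t) y i ≤ pow A t i i) :
    r ≤ nodeMcgm A i := by
  obtain ⟨d, hd, loop⟩ := hi
  have x_ne : mulVec (pow A (T * d)) y i ≠ 0 := mulVec_pow_ne_zero.2 ⟨i, hyi, loop.mul_left T⟩
  refine le_of_pow_le_pow_left₀ (mul_pos hd hN).ne' zero_le
    (le_of_forall_pow_mul_le (c := nodeMcgm A i ^ (T * d)) x_ne fun k => ?_)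
  calc (r ^ (d * N)) ^ k * mulVec (pow A (T * d)) y i
      = mulVec (pow A (T * d + k * d * N)) y i := by
        rw [mulVec_pow_add_mul_eq h (Nat.le_mul_of_pos_right T hd), Pi.smul_apply, smul_eq_mul,
          ← pow_mul, mul_comm (d * N), mul_assoc k]
    _ ≤ pow A (T * d + k * d * N) i i := hle _ (by
        rw [show T * d + k * d * N = (T + k * N) * d by ring]
        exact loop.mul_left _)
    _ ≤ nodeMcgm A i ^ (T * d + k * d * N) := pow_le_nodeMcgm_pow i _
    _ = (nodeMcgm A i ^ (d * N)) ^ k * nodeMcgm A i ^ (T * d) := by ring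

lemma nodeMcgm_le_of_accesses {i j : Fin n} (hj : OnCycle (digraph A) j)
    (h : UltimatelyLinearPeriodic A (unitVec j ⊔ unitVec j)) (hij : Accesses (digraph A) i j) :
    nodeMcgm A i ≤ nodeMcgm A j := by
  obtain ⟨r, T, hr⟩ := h
  have hyj := unitVec_sup_left_ne_zero j j
  calc nodeMcgm A i ≤ r := nodeMcgm_le_of_accesses_support (jointCyclicity_pos A) hr hyj hij
    _ ≤ nodeMcgm A j := le_nodeMcgm_of_mulVec_pow_le (jointCyclicity_pos A) hr hj hyj
      fun t _ => by rw [sup_idem, mulVec_unitVec]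

lemma nodeMcgm_eq_of_not_accesses {i j : Fin n} (hi : OnCycle (digraph A) i)
    (hj : OnCycle (digraph A) j)
    (h : ∀ i, OnCycle (digraph A) i → UltimatelyLinearPeriodic A (unitVec i ⊔ unitVec j))
    (hij : ¬ StronglyAccesses (digraph A) i j) (hji : ¬ Accesses (digraph A) j i) :
    nodeMcgm A i = nodeMcgm A j := by
  obtain ⟨i', hs, disjoint_lengths⟩ := hi.exists_disjoint_lengths hij
  have hi' := hs.onCycle hi
  obtain ⟨r, T, hr⟩ := h i' hi'
  have hyi := unitVec_sup_left_ne_zero i' j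
  have hyj : (unitVec i' ⊔ unitVec j : Fin n → ℝ≥0) j ≠ 0 :=
    sup_comm (unitVec i') _ ▸ unitVec_sup_left_ne_zero j i'
  have rate_le_i : r ≤ nodeMcgm A i' :=
    le_nodeMcgm_of_mulVec_pow_le (jointCyclicity_pos A) hr hi' hyi fun t ht => by
      have no_path : pow A t i' j = 0 :=
        not_not.1 (mt hasPath_digraph.2 (disjoint_lengths t ht))
      simp [mulVec_sup, mulVec_unitVec, no_path]
  have rate_le_j : r ≤ nodeMcgm A j :=
    le_nodeMcgm_of_mulVec_pow_le (jointCyclicity_pos A) hr hj hyj fun t _ => by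
      have no_path : pow A t j i' = 0 :=
        not_not.1 (mt hasPath_digraph.2 fun hp => hji (.trans ⟨t, hp⟩ hs.2))
      simp [mulVec_sup, mulVec_unitVec, no_path]
  have le_rate : ∀ {l k}, (unitVec i' ⊔ unitVec j : Fin n → ℝ≥0) k ≠ 0 →
      Accesses (digraph A) l k → nodeMcgm A l ≤ r :=
    nodeMcgm_le_of_accesses_support (jointCyclicity_pos A) hr
  rw [nodeMcgm_congr hs]
  exact ((le_rate hyi (.refl i')).antisymm rate_le_i).trans
    (rate_le_j.antisymm (le_rate hyj (.refl j)))

lemma nodeMcgm_eq_of_not_stronglyAccesses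
    (h : ∀ i j, OnCycle (digraph A) i → OnCycle (digraph A) j →
      UltimatelyLinearPeriodic A (unitVec i ⊔ unitVec j)) {i j : Fin n}
    (hi : OnCycle (digraph A) i) (hj : OnCycle (digraph A) j)
    (hji : ¬ StronglyAccesses (digraph A) j i) (hij : ¬ StronglyAccesses (digraph A) i j) :
    nodeMcgm A i = nodeMcgm A j := by
  by_cases h1 : Accesses (digraph A) j i
  · by_cases h2 : Accesses (digraph A) i j
    · exact nodeMcgm_congr ⟨h2, h1⟩
    · exact (nodeMcgm_eq_of_not_accesses hj hi (fun l hl => h l i hl hi) hji h2).symm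
  · exact nodeMcgm_eq_of_not_accesses hi hj (fun l hl => h l j hl hj) hij h1

theorem conditions_of_ultimatelyLinearPeriodic
    (h : ∀ i j, OnCycle (digraph A) i → OnCycle (digraph A) j →
      UltimatelyLinearPeriodic A (unitVec i ⊔ unitVec j)) (i j : Fin n)
    (hi : OnCycle (digraph A) i) (hj : OnCycle (digraph A) j) :
    (Accesses (digraph A) i j → nodeMcgm A i ≤ nodeMcgm A j) ∧
      (¬ StronglyAccesses (digraph A) j i ∧ ¬ StronglyAccesses (digraph A) i j →
        nodeMcgm A i = nodeMcgm A j) :=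
  ⟨nodeMcgm_le_of_accesses hj (h j j hj hj),
    fun ⟨hji, hij⟩ => nodeMcgm_eq_of_not_stronglyAccesses h hi hj hji hij⟩

end Necessity

end MaxAlgebra

/-- `e_i ⊕ e_j` is the pointwise maximum `unitVec i ⊔ unitVec j`. -/
theorem theorem7p4 {n : ℕ} (A : Matrix (Fin n) (Fin n) ℝ≥0) :
    (MaxAlgebra.OrbitPeriodic A ↔
      ∀ i j : Fin n, MaxAlgebra.OnCycle (MaxAlgebra.digraph A) i →
        MaxAlgebra.OnCycle (MaxAlgebra.digraph A) j →
        (MaxAlgebra.Accesses (MaxAlgebra.digraph A) i j →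
          MaxAlgebra.nodeMcgm A i ≤ MaxAlgebra.nodeMcgm A j) ∧
        (¬ MaxAlgebra.StronglyAccesses (MaxAlgebra.digraph A) j i ∧
            ¬ MaxAlgebra.StronglyAccesses (MaxAlgebra.digraph A) i j →
          MaxAlgebra.nodeMcgm A i = MaxAlgebra.nodeMcgm A j)) ∧
    (MaxAlgebra.OrbitPeriodic A ↔
      ∀ i j : Fin n, MaxAlgebra.OnCycle (MaxAlgebra.digraph A) i →
        MaxAlgebra.OnCycle (MaxAlgebra.digraph A) j →
        MaxAlgebra.UltimatelyLinearPeriodic A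
          (MaxAlgebra.unitVec i ⊔ MaxAlgebra.unitVec j)) := by
  refine ⟨⟨fun h => ?_, MaxAlgebra.orbitPeriodic_of_conditions⟩, fun h i j _ _ => h _, fun h => ?_⟩
  · exact MaxAlgebra.conditions_of_ultimatelyLinearPeriodic fun i j _ _ => h _
  · exact MaxAlgebra.orbitPeriodic_of_conditions
      (MaxAlgebra.conditions_of_ultimatelyLinearPeriodic h)
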